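/- Let $(G,T,\ell,u,w)$ be an instance of the Periodic Event Scheduling Problem: $G$ is a finite connected digraph with vertex set $V$ and arc set $A$, without loops, parallel arcs or antiparallel arcs, $T\ge 1$ is an integer, and $\ell,u,w\in\mathbb R^A$ with $0\le \ell_a<T$ and $0<u_a-\ell_a<T$ for all $a\in A$. Let $B\in\{-1,0,1\}^{V\times A}$ be the incidence matrix of $G$ (the column of an arc has $+1$ at its tail and $-1$ at its head), and let $\Gamma$ be the cycle matrix of an integral cycle basis $\mathscr B$ of $G$: its rows are $\mu=\operatorname{rank}(\mathcal C)$ oriented cycles generating the cycle space $\mathcal C\subseteq\mathbb Z^A$, where an oriented cycle is a vector $\gamma\in\{-1,0,1\}^A$ with $B\gamma=0$, and $\mathcal C$ is the subgroup generated by all of them. Put $X_{\mathrm{LP}}=\{x\in\mathbb R^A: \ell\le x\le u\}$, let $Z=\{z\in\mathbb R^{\mathscr B}:\exists x\in X_{\mathrm{LP}},\ \Gamma x=Tz\}$ be the cycle offset zonotope, and let $\Gamma'$ be $\Gamma$ with each column $a$ scaled by $(u_a-\ell_a)/T$, so that $Z$ is a translate of the zonotope of $\Gamma'$. A zonotopal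 tiling of $Z$ is a polyhedral subdivision of $Z$ all of whose cells are translates of zonotopes generated by subsets of the columns of $\Gamma'$; its maximal cells are called tiles, and it is fine if every tile is a translate of a zonotope generated by linearly independent columns. For disjoint $L,U\subseteq A$ let $\mathscr F_{L,U}=\{x\in X_{\mathrm{LP}}: x_a=\ell_a\ (a\in L),\ x_a=u_a\ (a\in U)\}$. The triple $(S,L,U)$ with $S=L\sqcup U$ is a spanning tree structure if $S$ is the arc set of a spanning tree of $G$. Let $\overline G$ be the digraph obtained from $G$ by adding the reverse of every arc, and let $\overline G_{L,U}$ be its spanning subgraph consisting of the arcs in $U$ and the reverses of the arcs in $L$. For $p\in\mathbb Z^A$ let $\kappa(p)$ be the weights on $\overline G$ that give $a$ the weight $u_a-Tp_a$ and the reverse of $a$ the weight $Tp_a-\ell_a$, and let $R(p)=\{\pi\in\mathbb R^V:\ \ell\le -B^{\top}\pi+Tp\le u\}$. For $z\in\mathbb Z^{\mathscr B}$ let $\mathfrak R(z)$ be the image of $R(p)$ in the torus $(\mathbb R^V/(T\mathbb Z)^V)/\mathbb R\mathbf 1$ for any $p\in\mathbb Z^A$ with $\Gamma p=z$ (it does not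 depend on $p$). The tropical vertices of $R(p)/\mathbb R\mathbf 1$ are the elements of its minimal generating set with respect to the (min-plus) tropical convex hull. For $i\in V$, the $i$-th one is the class of any $\pi$ such that $\pi_j-\pi_i$ is the shortest path distance from $i$ to $j$ in $(\overline G,\kappa(p))$ for all $j\in V$; its class in the torus is the $i$-th tropical vertex of $\mathfrak R(z)$. Finally, let $P_i=X_{\mathrm{LP}}+\operatorname{pos}\{\text{columns of }B^{\top}\text{ other than the }i\text{-th}\}$. Theorem. Let $i\in V$. The images of the non-empty bounded faces of $P_i$ under $x\mapsto\frac1T\Gamma x$ are the cells of a fine zonotopal tiling of $Z$. For every tile $C$ of it there is a spanning tree structure $(S,L,U)$ such that $\mathscr F_{L,U}$ is a face of $P_i$, $C=\frac1T\Gamma(\mathscr F_{L,U})$, and $\overline G_{L,U}$ is an arborescence rooted at $i$; moreover, for every integer point $z\in C$, $\overline G_{L,U}$ is a shortest path arborescence rooted at $i$ in $(\overline G,\kappa(p))$ for every $p\in\mathbb Z^A$ with $\Gamma p=z$, and $(S,L,U)$ defines the $i$-th tropical vertex of $\mathfrak R(z)$: this vertex is the unique point of $\mathfrak R(z)$ whose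 tension $x=-B^{\top}\pi+Tp$ (with $\pi\in R(p)$, $\Gamma p=z$, representing the point) satisfies $x_a=\ell_a$ for all $a\in L$ and $x_a=u_a$ for all $a\in U$. -/

import Mathlib

open scoped Matrix Pointwise

/-! ### Polyhedral subdivisions and zonotopal tilings -/

/-- A polytope: the convex hull of a finite set of points. -/
def IsPolytope {E : Type*} [AddCommGroup E] [Module ℝ E] (C : Set E) : Prop :=
  ∃ s : Finset E, C = convexHull ℝ (s : Set E)

/-- A non-empty face of a polyhedron `P` (the polyhedron itself is one of its faces). -/
def IsFaceOf {E : Type*} [AddCommGroup E] [Module ℝ E] [TopologicalSpace E]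
    (P F : Set E) : Prop :=
  F.Nonempty ∧ IsExposed ℝ P F

/-- A polyhedral subdivision of `Z` into finitely many non-empty polytopes: the cells cover `Z`,
every face of a cell is a cell, and two cells that meet do so in a common face. -/
structure IsPolyhedralSubdivision {E : Type*} [AddCommGroup E] [Module ℝ E] [TopologicalSpace E]
    (Z : Set E) (cells : Set (Set E)) : Prop where
  finite : cells.Finite
  nonempty : ∀ C ∈ cells, C.Nonempty
  polytope : ∀ C ∈ cells, IsPolytope C
  cover : ⋃₀ cells = Z
  face_mem : ∀ C ∈ cells, ∀ F, IsFaceOf C F → F ∈ cells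
  inter : ∀ C ∈ cells, ∀ D ∈ cells, (C ∩ D).Nonempty →
    IsFaceOf C (C ∩ D) ∧ IsFaceOf D (C ∩ D)

/-- The tiles of a subdivision: its maximal cells. -/
def tiles {E : Type*} (cells : Set (Set E)) : Set (Set E) :=
  {C | Maximal (fun D => D ∈ cells) C}

/-- The zonotope of the matrix that arises from `M` by deleting the columns indexed by `S`. -/
def zonotopeDel {ι A : Type*} [Fintype A] (M : Matrix ι A ℝ) (S : Set A) : Set (ι → ℝ) :=
  {y | ∃ x : A → ℝ, (∀ a, 0 ≤ x a ∧ x a ≤ 1) ∧ (∀ a ∈ S, x a = 0) ∧ y = M *ᵥ x}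

/-- A zonotopal tiling of a translate `Z` of the zonotope of `M`: a polyhedral subdivision whose
cells are translates of zonotopes generated by some of the columns of `M`. -/
def IsZonotopalTiling {ι A : Type*} [Fintype A] (M : Matrix ι A ℝ) (Z : Set (ι → ℝ))
    (cells : Set (Set (ι → ℝ))) : Prop :=
  IsPolyhedralSubdivision Z cells ∧
    ∀ C ∈ cells, ∃ (S : Set A) (b : ι → ℝ), C = b +ᵥ zonotopeDel M S

/-- A fine zonotopal tiling: all tiles are parallelotopes, i.e. translates of zonotopes
with linearly independent generators. -/
def IsFineZonotopalTiling {ι A : Type*} [Fintype A] (M : Matrix ι A ℝ) (Z : Set (ι → ℝ))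
    (cells : Set (Set (ι → ℝ))) : Prop :=
  IsZonotopalTiling M Z cells ∧
    ∀ C ∈ tiles cells, ∃ (S : Set A) (b : ι → ℝ), C = b +ᵥ zonotopeDel M S ∧
      LinearIndependent ℝ (fun a : (Sᶜ : Set A) => fun k => M k a)

/-! ### Tropical convexity (min-plus) in `ℝ^V` -/

/-- Tropical convexity of a set of finite points. Such a set is invariant under adding multiples of
the all-ones vector, so it is the same thing as its image in `ℝ^V / ℝ𝟏`. -/
def IsTropicallyConvex {V : Type*} (S : Set (V → ℝ)) : Prop :=
  ∀ x ∈ S, ∀ y ∈ S, ∀ a b : ℝ, (fun v => min (a + x v) (b + y v)) ∈ S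

/-- The tropical convex hull. -/
def tropicalHull {V : Type*} (M : Set (V → ℝ)) : Set (V → ℝ) :=
  ⋂₀ {S | IsTropicallyConvex S ∧ M ⊆ S}

/-- `π` is (a representative modulo `ℝ𝟏` of) a tropical vertex of `R`: it belongs to a minimal
generating set of `R`. -/
def IsTropicalVertex {V : Type*} (R : Set (V → ℝ)) (π : V → ℝ) : Prop :=
  ∃ M : Set (V → ℝ), Minimal (fun N => tropicalHull N = R) M ∧ π ∈ M

/-! ### Instances of the periodic event scheduling problem -/

/-- The undirected graph on `V` spanned by the arcs in `S`. -/
def arcGraph {V A : Type*} (src tgt : A → V) (S : Set A) : SimpleGraph V :=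
  SimpleGraph.fromRel fun v w => ∃ a ∈ S, src a = v ∧ tgt a = w

/-- An instance `(G, T, l, u, w)` of the periodic event scheduling problem on a digraph `G` with
vertex set `V` and arc set `A`, where the arc `a` leads from `src a` to `tgt a`. -/
structure PESP (V A : Type*) where
  src : A → V
  tgt : A → V
  /-- no loops -/
  no_loop : ∀ a, src a ≠ tgt a
  /-- no parallel and no antiparallel arcs -/
  simple : ∀ a b, s(src a, tgt a) = s(src b, tgt b) → a = b
  connected : (arcGraph src tgt Set.univ).Connected
  /-- the period -/
  T : ℕ
  T_pos : 0 < T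
  l : A → ℝ
  u : A → ℝ
  w : A → ℝ
  l_nonneg : ∀ a, 0 ≤ l a
  l_lt : ∀ a, l a < T
  l_le_u : ∀ a, l a ≤ u a
  span_lt : ∀ a, u a - l a < T

namespace PESP

variable {V A ι : Type*}

/-- The incidence matrix `B`: the column of the arc `a` is `+1` at `src a` and `-1` at `tgt a`. -/
def incidence [DecidableEq V] (I : PESP V A) (R : Type*) [Ring R] : Matrix V A R :=
  Matrix.of fun v a => (if I.src a = v then 1 else 0) - (if I.tgt a = v then 1 else 0)

/-- `-Bᵀ π + T p`; at the arc `a = (i, j)` this is `π j - π i + T * p a`. -/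
def tension [DecidableEq V] [Fintype V] (I : PESP V A) (π : V → ℝ) (p : A → ℤ) : A → ℝ :=
  -((I.incidence ℝ)ᵀ *ᵥ π) + (I.T : ℝ) • (fun a => (p a : ℝ))

/-! #### Cycle bases and the cycle offset zonotope -/

/-- Oriented cycles: vectors `γ` with entries in `{-1, 0, 1}` such that `B γ = 0`. -/
def IsOrientedCycle [DecidableEq V] [Fintype A] (I : PESP V A) (γ : A → ℤ) : Prop :=
  (∀ a, γ a = -1 ∨ γ a = 0 ∨ γ a = 1) ∧ I.incidence ℤ *ᵥ γ = 0

/-- The cycle space: the subgroup of `ℤ^A` generated by the oriented cycles. -/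
def cycleSpace [DecidableEq V] [Fintype A] (I : PESP V A) : Submodule ℤ (A → ℤ) :=
  Submodule.span ℤ {γ | I.IsOrientedCycle γ}

/-- The rows of `Γ` form an integral cycle basis: they are `μ` oriented cycles that generate the
cycle space, where `μ` is the rank of the cycle space. -/
structure IsIntegralCycleBasis [DecidableEq V] [Fintype A] [Fintype ι] (I : PESP V A)
    (Γ : Matrix ι A ℤ) : Prop where
  card_eq : Fintype.card ι = Module.finrank ℤ I.cycleSpace
  oriented : ∀ k, I.IsOrientedCycle (Γ k)
  span_eq : Submodule.span ℤ (Set.range fun k => Γ k) = I.cycleSpace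

/-- The map `x ↦ Γ x / T`. -/
noncomputable def offsetMap [Fintype A] (I : PESP V A) (Γ : Matrix ι A ℤ) (x : A → ℝ) : ι → ℝ :=
  (I.T : ℝ)⁻¹ • (Γ.map (Int.cast : ℤ → ℝ) *ᵥ x)

/-- The cycle offset zonotope `Z`. -/
def offsetZonotope [Fintype A] (I : PESP V A) (Γ : Matrix ι A ℤ) : Set (ι → ℝ) :=
  {z | ∃ x : A → ℝ, Γ.map (Int.cast : ℤ → ℝ) *ᵥ x = (I.T : ℝ) • z ∧
    ∀ a, I.l a ≤ x a ∧ x a ≤ I.u a}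

/-- The matrix `Γ'`: the column `a` of `Γ` is scaled by `(u a - l a) / T`. -/
noncomputable def scaledCycleMatrix (I : PESP V A) (Γ : Matrix ι A ℤ) : Matrix ι A ℝ :=
  Matrix.of fun k a => (Γ k a : ℝ) * ((I.u a - I.l a) / I.T)

/-! #### Structures, the cube `X_LP` and the polyhedron `P_i` -/

/-- The fractional periodic tension polytope `X_LP`. -/
def cube (I : PESP V A) : Set (A → ℝ) :=
  {x | ∀ a, I.l a ≤ x a ∧ x a ≤ I.u a}

/-- The face `F_{L,U}` of the cube. -/
def cubeFace (I : PESP V A) (L U : Set A) : Set (A → ℝ) :=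
  {x | x ∈ I.cube ∧ (∀ a ∈ L, x a = I.l a) ∧ (∀ a ∈ U, x a = I.u a)}

/-- `(S, L, U)` is a spanning tree structure. -/
def IsSpanningTreeStructure (I : PESP V A) (S L U : Set A) : Prop :=
  S = L ∪ U ∧ L ∩ U = ∅ ∧ (arcGraph I.src I.tgt S).IsTree

/-- The polyhedron `P_i`: the Minkowski sum of the cube and the cone generated by the columns of
`Bᵀ` other than the column of `i`. -/
def coneSum [DecidableEq V] [Fintype V] (I : PESP V A) (i : V) : Set (A → ℝ) :=
  I.cube + {y | ∃ c : V → ℝ, (∀ j, 0 ≤ c j) ∧ c i = 0 ∧ y = (I.incidence ℝ)ᵀ *ᵥ c}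

/-- The collection of the images of the bounded faces of `P_i` under `x ↦ Γ x / T`. -/
def inducedCells [DecidableEq V] [Fintype V] [Fintype A] (I : PESP V A) (Γ : Matrix ι A ℤ)
    (i : V) : Set (Set (ι → ℝ)) :=
  {C | ∃ F, IsFaceOf (I.coneSum i) F ∧ Bornology.IsBounded F ∧ C = I.offsetMap Γ '' F}

/-! #### The weighted digraph `(Ḡ, κ(p))` and shortest path arborescences -/

/-- Tail of an arc of `Ḡ`. The arcs of `Ḡ` are the arcs of `G`, as `Sum.inl a`, and their reverses,
as `Sum.inr a`. -/
def barSrc (I : PESP V A) : A ⊕ A → V := Sum.elim I.src I.tgt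

/-- Head of an arc of `Ḡ`. -/
def barTgt (I : PESP V A) : A ⊕ A → V := Sum.elim I.tgt I.src

/-- The arc weights `κ(p)` of `Ḡ`. -/
def kappa (I : PESP V A) (p : A → ℤ) : A ⊕ A → ℝ :=
  Sum.elim (fun a => I.u a - I.T * p a) (fun a => I.T * p a - I.l a)

/-- The arc set of the subgraph `Ḡ_{L,U}` of `Ḡ`: arcs in `U` are used forwards, arcs in `L`
backwards. -/
def barArcs (L U : Set A) : Set (A ⊕ A) := Sum.inl '' U ∪ Sum.inr '' L

/-- `I.IsWalk κ K v w c`: in the subgraph of `Ḡ` with arc set `K` there is a directed walk from `v`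
to `w` of total weight `c`. -/
inductive IsWalk (I : PESP V A) (κ : A ⊕ A → ℝ) (K : Set (A ⊕ A)) : V → V → ℝ → Prop
  | nil (v : V) : IsWalk I κ K v v 0
  | snoc {v : V} {c : ℝ} (e : A ⊕ A) (he : e ∈ K) (h : IsWalk I κ K v (I.barSrc e) c) :
      IsWalk I κ K v (I.barTgt e) (c + κ e)

/-- The arcs in `K` form a spanning arborescence of `Ḡ` rooted at `i`. -/
structure IsArborescence (I : PESP V A) (K : Set (A ⊕ A)) (i : V) : Prop where
  reachable : ∀ v, Relation.ReflTransGen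
    (fun x y => ∃ e ∈ K, I.barSrc e = x ∧ I.barTgt e = y) i v
  root : ∀ e ∈ K, I.barTgt e ≠ i
  unique_in : ∀ v, v ≠ i → ∃! e, e ∈ K ∧ I.barTgt e = v

/-- The arcs in `K` form a shortest path arborescence of `(Ḡ, κ)` rooted at `i`. -/
def IsShortestPathArborescence (I : PESP V A) (κ : A ⊕ A → ℝ) (K : Set (A ⊕ A)) (i : V) : Prop :=
  I.IsArborescence K i ∧
    ∀ v c, I.IsWalk κ K i v c → ∀ c', I.IsWalk κ Set.univ i v c' → c ≤ c'

/-! #### Timetable polytropes -/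

/-- The polyhedron `R(p)`. -/
def timetablePolyhedron (I : PESP V A) (p : A → ℤ) : Set (V → ℝ) :=
  {π | ∀ a, I.l a - I.T * p a ≤ π (I.tgt a) - π (I.src a) ∧
    π (I.tgt a) - π (I.src a) ≤ I.u a - I.T * p a}

/-- `π` represents the `i`-th tropical vertex of the polytrope `R(p)/ℝ𝟏`: the tropical vertex given
by the shortest path distances from `i` in `(Ḡ, κ(p))`. -/
def IsTropicalVertexAt (I : PESP V A) (p : A → ℤ) (i : V) (π : V → ℝ) : Prop :=
  IsTropicalVertex (I.timetablePolyhedron p) π ∧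
    ∀ j, IsLeast {c | I.IsWalk (I.kappa p) Set.univ i j c} (π j - π i)

/-- The subgroup `(Tℤ)^V + ℝ𝟏` of `ℝ^V`. -/
def torusLattice (I : PESP V A) : AddSubgroup (V → ℝ) where
  carrier := {π | ∃ (q : V → ℤ) (c : ℝ), ∀ v, π v = I.T * q v + c}
  zero_mem' := ⟨0, 0, fun v => by simp⟩
  add_mem' := by
    rintro x y ⟨q, c, h⟩ ⟨q', c', h'⟩
    exact ⟨q + q', c + c', fun v => by simp only [Pi.add_apply, h v, h' v]; push_cast; ring⟩
  neg_mem' := by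
    rintro x ⟨q, c, h⟩
    exact ⟨-q, -c, fun v => by simp only [Pi.neg_apply, h v]; push_cast; ring⟩

/-- The torus `(ℝ^V / (Tℤ)^V) / ℝ𝟏` of periodic timetables. -/
abbrev Torus (I : PESP V A) : Type _ := (V → ℝ) ⧸ I.torusLattice

/-- The class of a timetable in the torus. -/
def toTorus (I : PESP V A) (π : V → ℝ) : I.Torus := QuotientAddGroup.mk π

/-- The graph of the embedding of the polytrope `ℜ(z)` of the torus into the space of tensions:
the point of the torus represented by `π ∈ R(p)`, where `Γ p = z`, is mapped to `-Bᵀ π + T p`. -/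
def IsTensionOf [DecidableEq V] [Fintype V] [Fintype A] (I : PESP V A) (Γ : Matrix ι A ℤ)
    (z : ι → ℤ) (t : I.Torus) (x : A → ℝ) : Prop :=
  ∃ (p : A → ℤ) (π : V → ℝ), Γ *ᵥ p = z ∧ π ∈ I.timetablePolyhedron p ∧ I.toTorus π = t ∧
    x = I.tension π p

/-- The polytrope `ℜ(z)` of the torus: the image of `R(p)`, for `p` with `Γ p = z` (it does not
depend on the choice of `p`). -/
def torusPolytrope [Fintype A] (I : PESP V A) (Γ : Matrix ι A ℤ) (z : ι → ℤ) : Set I.Torus :=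
  {t | ∃ p : A → ℤ, Γ *ᵥ p = z ∧ t ∈ I.toTorus '' I.timetablePolyhedron p}

/-- `t` is the `i`-th tropical vertex of `ℜ(z)`: for every `p` with `Γ p = z` it is the class of
the `i`-th tropical vertex of `R(p)/ℝ𝟏`. -/
def IsTorusTropicalVertexAt [Fintype A] (I : PESP V A) (Γ : Matrix ι A ℤ) (z : ι → ℤ) (i : V)
    (t : I.Torus) : Prop :=
  t ∈ I.torusPolytrope Γ z ∧
    ∀ p : A → ℤ, Γ *ᵥ p = z → ∃ π, I.IsTropicalVertexAt p i π ∧ I.toTorus π = t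

/-- `(L, U)` defines the point `t` of `ℜ(z)`: `t` is the one point of `ℜ(z)` whose tension attains
the lower bounds on `L` and the upper bounds on `U`. -/
def DefinesPoint [DecidableEq V] [Fintype V] [Fintype A] (I : PESP V A) (Γ : Matrix ι A ℤ)
    (z : ι → ℤ) (L U : Set A) (t : I.Torus) : Prop :=
  {t' | ∃ x ∈ I.cubeFace L U, I.IsTensionOf Γ z t' x} = {t}

end PESP

/-! Everything rests on one condition on disjoint $L,U$: in $\overline G_{L,U}$ every vertex is
reachable from $i$ (`ReachesAll`). A functional $f$ cuts out a bounded face of $P_i$ exactly when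
$(Bf)_j<0$ for all $j\ne i$, and the face is then $\mathscr F_{L,U}$ with $L=\{f<0\}$ and
$U=\{f>0\}$. Read as a flow, such an $f$ delivers goods to every vertex other than $i$, which is
possible with these signs if and only if the reachability condition holds (`mem_inducedCells_iff`).

Two points $x,y$ of a fibre of $x\mapsto\frac1T\Gamma x$ differ by a potential difference. If
$x\in\mathscr F_{L,U}$ and $y$ lies in the cube, the potential of $y-x$ cannot decrease along arcs
of $\overline G_{L,U}$, so under reachability it is minimal at $i$ (`ReachesAll.potential_le`). By
symmetry a fibre meets the bounded faces in at most one point (`eq_of_offsetMap_eq`). It meets them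
at all because a maximizer over the fibre of a suitable $f$ lies in one (`exists_mem_cubeFace`). So
the union of the bounded faces maps bijectively onto $Z$, and intersections map to intersections.
Functionals on $Z$ correspond to circulations, which matches the faces of cells with smaller cube
faces (`isFaceOf_offsetMap_image`). Reachability makes $L\cup U$ connected, so the remaining columns
of $\Gamma'$ are independent and the tiling is fine.

An arborescence inside $\overline G_{L,U}$ gives a larger cell, so a tile already comes from an
arborescence. Over an integer point the tension is that of some $\pi\in R(p)$: tightness on $L,U$
makes $\pi_j-\pi_i$ the length of the path in the arborescence, and feasibility bounds all other
walks from below. The same extremality at $i$ makes $\pi$ a tropical vertex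
(`isTropicalVertex_of_forall_le`). -/

namespace PESP

/-! ### The incidence matrix as divergence and coboundary -/

section Incidence

variable {V A ι R : Type*} [DecidableEq V]

theorem incidence_transpose_mulVec [Fintype V] [CommRing R] (I : PESP V A) (c : V → R) :
    (I.incidence R)ᵀ *ᵥ c = fun a => c (I.src a) - c (I.tgt a) := by
  ext a
  simp [Matrix.mulVec, dotProduct, incidence, sub_mul, Finset.sum_sub_distrib]

theorem tension_apply [Fintype V] (I : PESP V A) (π : V → ℝ) (p : A → ℤ) (a : A) :
    I.tension π p a = π (I.tgt a) - π (I.src a) + I.T * p a := by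
  simp [tension, incidence_transpose_mulVec]

theorem sum_incidence_mulVec_mul [Fintype V] [Fintype A] [CommRing R] (I : PESP V A)
    (h : A → R) (c : V → R) :
    ∑ v, (I.incidence R *ᵥ h) v * c v = ∑ a, h a * (c (I.src a) - c (I.tgt a)) := by
  have := Matrix.dotProduct_mulVec h (I.incidence R)ᵀ c
  rw [Matrix.vecMul_transpose, incidence_transpose_mulVec] at this
  exact this.symm

theorem incidence_mulVec_single [Fintype A] [DecidableEq A] [CommRing R] (I : PESP V A) (a : A)
    (r : R) :
    I.incidence R *ᵥ Pi.single a r = Pi.single (I.src a) r - Pi.single (I.tgt a) r := by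
  ext v
  simp [incidence, Pi.single_apply, sub_mul, eq_comm]

theorem incidence_mulVec_intCast [Fintype A] [CommRing R] (I : PESP V A) (h : A → ℤ) :
    (I.incidence R *ᵥ fun a => (h a : R)) = fun v => ((I.incidence ℤ *ᵥ h) v : R) := by
  ext v
  simp [Matrix.mulVec, dotProduct, incidence]

end Incidence

/-! ### Spanning forests, fundamental cycles and potentials -/

section ArcGraph

variable {V A : Type*}

theorem arcGraph_adj_iff {src tgt : A → V} {S : Set A} {v w : V} :
    (arcGraph src tgt S).Adj v w ↔
      v ≠ w ∧ ∃ a ∈ S, (src a = v ∧ tgt a = w) ∨ (src a = w ∧ tgt a = v) := by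
  simp only [arcGraph, SimpleGraph.fromRel_adj]
  aesop

theorem arcGraph_reachable (I : PESP V A) {S : Set A} {a : A} (ha : a ∈ S) :
    (arcGraph I.src I.tgt S).Reachable (I.src a) (I.tgt a) :=
  SimpleGraph.Adj.reachable (arcGraph_adj_iff.2 ⟨I.no_loop a, a, ha, Or.inl ⟨rfl, rfl⟩⟩)

/-- A function that agrees at the ends of all arcs in `S` is constant on the components. -/
theorem eq_of_arcGraph_reachable {β : Type*} {src tgt : A → V} {S : Set A} {c : V → β}
    (hc : ∀ a ∈ S, c (src a) = c (tgt a)) {v w : V} (h : (arcGraph src tgt S).Reachable v w) :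
    c v = c w := by
  obtain ⟨p⟩ := h
  induction p with
  | nil => rfl
  | cons hadj _ ih =>
    obtain ⟨-, a, ha, ⟨rfl, rfl⟩ | ⟨rfl, rfl⟩⟩ := arcGraph_adj_iff.1 hadj
    · rw [hc a ha, ih]
    · rw [← hc a ha, ih]

/-- A trail yields a `{-1, 0, 1}`-flow from its start to its end. -/
theorem exists_flow_of_isTrail [DecidableEq V] [Fintype A] (I : PESP V A) {S : Set A} {v w : V}
    (p : (arcGraph I.src I.tgt S).Walk v w) (hp : p.IsTrail) :
    ∃ χ : A → ℤ, (∀ a, χ a = -1 ∨ χ a = 0 ∨ χ a = 1) ∧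
      (∀ a, χ a ≠ 0 → a ∈ S ∧ s(I.src a, I.tgt a) ∈ p.edges) ∧
      I.incidence ℤ *ᵥ χ = Pi.single v 1 - Pi.single w 1 := by
  classical
  induction p with
  | nil => exact ⟨0, by simp, by simp, by simp⟩
  | @cons v u w hadj p ih =>
    rw [SimpleGraph.Walk.isTrail_cons] at hp
    obtain ⟨χ, h1, h2, h3⟩ := ih hp.1
    obtain ⟨-, a, ha, hor⟩ := arcGraph_adj_iff.1 hadj
    have hedge : s(I.src a, I.tgt a) = s(v, u) := by
      rcases hor with ⟨rfl, rfl⟩ | ⟨rfl, rfl⟩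
      · rfl
      · exact Sym2.eq_swap
    have ha0 : χ a = 0 := by
      by_contra h
      exact hp.2 (hedge ▸ (h2 a h).2)
    obtain ⟨ε, hε, hB⟩ : ∃ ε : ℤ, (ε = -1 ∨ ε = 1) ∧
        I.incidence ℤ *ᵥ Pi.single a ε = Pi.single v 1 - Pi.single u 1 := by
      rcases hor with ⟨rfl, rfl⟩ | ⟨rfl, rfl⟩
      · exact ⟨1, Or.inr rfl, I.incidence_mulVec_single a 1⟩
      · refine ⟨-1, Or.inl rfl, ?_⟩
        rw [incidence_mulVec_single]
        simp only [Pi.single_neg]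
        abel
    refine ⟨χ + Pi.single a ε, fun b => ?_, fun b hb => ?_, ?_⟩
    · by_cases hba : b = a
      · subst hba
        simp only [Pi.add_apply, ha0, Pi.single_eq_same]
        omega
      · simpa [hba] using h1 b
    · by_cases hba : b = a
      · subst hba
        exact ⟨ha, by simp [hedge]⟩
      · have := h2 b (by simpa [hba] using hb)
        exact ⟨this.1, by simp [this.2]⟩
    · rw [Matrix.mulVec_add, h3, hB]
      abel

/-- A maximal forest `S`, given by the cut functions `c` of its arcs. -/
theorem exists_maximal_forest [Finite A] (I : PESP V A) :
    ∃ (S : Set A) (c : A → V → ℤ),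
      (∀ a ∈ S, c a (I.src a) - c a (I.tgt a) = 1) ∧
      (∀ a ∈ S, ∀ b ∈ S, b ≠ a → c a (I.src b) = c a (I.tgt b)) ∧
      ∀ a ∉ S, (arcGraph I.src I.tgt S).Reachable (I.tgt a) (I.src a) := by
  classical
  obtain ⟨S, ⟨c, hc1, hc2⟩, hmax⟩ := Set.Finite.exists_maximal
    (s := {S : Set A | ∃ c : A → V → ℤ,
      (∀ a ∈ S, c a (I.src a) - c a (I.tgt a) = 1) ∧
      (∀ a ∈ S, ∀ b ∈ S, b ≠ a → c a (I.src b) = c a (I.tgt b))})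
    (Set.toFinite _) ⟨∅, 0, by simp, by simp⟩
  refine ⟨S, c, hc1, hc2, fun a ha => ?_⟩
  by_contra hr
  refine ha (hmax (y := insert a S) ?_ (Set.subset_insert a S) (Set.mem_insert a S))
  let d : V → ℤ := fun v => if (arcGraph I.src I.tgt S).Reachable (I.src a) v then 1 else 0
  have hd1 : d (I.src a) = 1 := by simp [d]
  have hd2 : d (I.tgt a) = 0 := by
    have : ¬ (arcGraph I.src I.tgt S).Reachable (I.src a) (I.tgt a) := fun h => hr h.symm
    simp [d, this]
  have hd3 : ∀ b ∈ S, d (I.src b) = d (I.tgt b) := by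
    intro b hb
    have := I.arcGraph_reachable hb
    have hiff : (arcGraph I.src I.tgt S).Reachable (I.src a) (I.src b) ↔
        (arcGraph I.src I.tgt S).Reachable (I.src a) (I.tgt b) :=
      ⟨fun h => h.trans this, fun h => h.trans this.symm⟩
    simp only [d, hiff]
  -- The new arc gets the indicator of a component as its cut function. The old cut functions are
  -- corrected by a multiple of it so that they no longer jump across `a`; on arcs of `S` nothing
  -- changes because `d` is constant there.
  refine ⟨fun b v => if b = a then d v else
    c b v - (c b (I.src a) - c b (I.tgt a)) * d v, ?_, ?_⟩
  · rintro b (rfl | hb)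
    · simp [hd1, hd2]
    · have hba : b ≠ a := fun h => ha (h ▸ hb)
      simp only [hba, if_false, hd3 b hb]
      linarith [hc1 b hb]
  · rintro b hb e he heb
    by_cases hba : b = a
    · subst hba
      simpa using hd3 e (he.resolve_left heb)
    · have hb' := hb.resolve_left hba
      rcases he with rfl | he
      · simp only [hba, if_false, hd1, hd2]
        ring
      · simp only [hba, if_false, hd3 e he, hc2 b hb' e he heb]

/-- An arc outside the forest is closed up by the forest path from its head to its tail. Setting `γ
a = 0` on the forest lets all later sums run over the whole of `A`. -/
theorem exists_fundamental_cycles [DecidableEq V] [Fintype A] (I : PESP V A) :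
    ∃ (S : Set A) (c : A → V → ℤ) (γ : A → A → ℤ),
      (∀ a ∈ S, c a (I.src a) - c a (I.tgt a) = 1) ∧
      (∀ a ∈ S, ∀ b ∈ S, b ≠ a → c a (I.src b) = c a (I.tgt b)) ∧
      (∀ a, I.IsOrientedCycle (γ a)) ∧ (∀ a ∈ S, γ a = 0) ∧ (∀ a ∉ S, γ a a = 1) ∧
      ∀ a, ∀ b ∉ S, b ≠ a → γ a b = 0 := by
  classical
  obtain ⟨S, c, h1, h2, h3⟩ := I.exists_maximal_forest
  have key : ∀ a, ∃ γ : A → ℤ, I.IsOrientedCycle γ ∧ (a ∈ S → γ = 0) ∧ (a ∉ S → γ a = 1) ∧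
      ∀ b ∉ S, b ≠ a → γ b = 0 := by
    intro a
    by_cases ha : a ∈ S
    · exact ⟨0, ⟨by simp, by simp⟩, by simp, by simp [ha], by simp⟩
    · obtain ⟨p, hp⟩ := (h3 a ha).exists_isPath
      obtain ⟨χ, hχ1, hχ2, hχ3⟩ := I.exists_flow_of_isTrail p hp.isTrail
      have h0 : ∀ b ∉ S, χ b = 0 := fun b hb => by
        by_contra h
        exact hb (hχ2 b h).1
      refine ⟨χ + Pi.single a 1, ⟨fun b => ?_, ?_⟩, fun h => absurd h ha, fun _ => ?_,
        fun b hb hba => ?_⟩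
      · by_cases hba : b = a
        · subst hba
          simp [h0 b ha]
        · simpa [hba] using hχ1 b
      · rw [Matrix.mulVec_add, hχ3, incidence_mulVec_single]
        abel
      · simp [h0 a ha]
      · simp [h0 b hb, hba]
  choose γ hγ1 hγ2 hγ3 hγ4 using key
  exact ⟨S, c, γ, h1, h2, hγ1, hγ2, hγ3, hγ4⟩

/-- Circulations are combinations of fundamental cycles, and a vector that is orthogonal to all
oriented cycles is a potential difference. -/
theorem exists_cycles_decomposition [Fintype V] [DecidableEq V] [Fintype A] (I : PESP V A) (R : Type*)
    [CommRing R] :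
    ∃ γ : A → A → ℤ, (∀ a, I.IsOrientedCycle (γ a)) ∧
      (∀ h : A → R, I.incidence R *ᵥ h = 0 → ∀ b, h b = ∑ a, h a * (γ a b : R)) ∧
      ∀ x : A → R, (∀ a, ∑ b, (γ a b : R) * x b = 0) →
        ∃ c : V → R, x = (I.incidence R)ᵀ *ᵥ c := by
  classical
  obtain ⟨S, c, γ, hc1, hc2, hγ1, hγ2, hγ3, hγ4⟩ := I.exists_fundamental_cycles
  have hcirc : ∀ a, ∀ e : V → R,
      ∑ b, (γ a b : R) * (e (I.src b) - e (I.tgt b)) = 0 := by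
    intro a e
    rw [← sum_incidence_mulVec_mul I (fun b => (γ a b : R)) e, incidence_mulVec_intCast,
      (hγ1 a).2]
    simp
  refine ⟨γ, hγ1, fun h hh => ?_, fun x hx => ?_⟩
  -- The residual is a circulation supported on the forest. Pairing it with the cut function of a
  -- forest arc isolates the entry at that arc, which is therefore zero.
  · set d : A → R := fun b => h b - ∑ a, h a * (γ a b : R) with hd
    have hd0 : ∀ b ∉ S, d b = 0 := by
      intro b hb
      simp only [hd]
      rw [Finset.sum_eq_single b]
      · simp [hγ3 b hb]
      · intro a _ hab
        simp [hγ4 a b hb hab.symm]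
      · simp
    have hpair : ∀ e : V → R, ∑ b, d b * (e (I.src b) - e (I.tgt b)) = 0 := by
      intro e
      simp only [hd, sub_mul (h _), Finset.sum_sub_distrib, Finset.sum_mul]
      rw [Finset.sum_comm, ← sum_incidence_mulVec_mul, hh]
      simp only [mul_assoc, ← Finset.mul_sum, hcirc]
      simp
    intro b
    have : d b = 0 := by
      by_cases hb : b ∈ S
      · have := hpair (fun v => (c b v : R))
        rw [Finset.sum_eq_single b] at this
        · rw [← Int.cast_sub, hc1 b hb] at this
          simpa using this
        · intro a _ hab
          by_cases ha : a ∈ S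
          · simp [hc2 b hb a ha hab]
          · simp [hd0 a ha]
        · simp
      · exact hd0 b hb
    exact sub_eq_zero.1 this
  -- This combination of cut functions has the prescribed differences on the forest. Off the forest,
  -- orthogonality to the fundamental cycle of an arc leaves only the entry of that arc.
  · let e : V → R := fun v => ∑ a, if a ∈ S then x a * (c a v : R) else 0
    have heS : ∀ b ∈ S, e (I.src b) - e (I.tgt b) = x b := by
      intro b hb
      simp only [e, ← Finset.sum_sub_distrib]
      rw [Finset.sum_eq_single b]
      · have := hc1 b hb
        simp only [hb, if_true, ← mul_sub, ← Int.cast_sub, this]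
        simp
      · intro a _ hab
        by_cases ha : a ∈ S
        · simp [ha, hc2 a ha b hb hab.symm]
        · simp [ha]
      · simp
    refine ⟨e, ?_⟩
    rw [incidence_transpose_mulVec]
    ext b
    by_cases hb : b ∈ S
    · exact (heS b hb).symm
    · have h1 : ∑ a, (γ b a : R) * (x a - (e (I.src a) - e (I.tgt a))) = 0 := by
        simp only [mul_sub (Int.cast _) (x _), Finset.sum_sub_distrib, hx, hcirc, sub_zero]
      rw [Finset.sum_eq_single b] at h1
      · rw [hγ3 b hb] at h1
        simpa [sub_eq_zero] using h1
      · intro a _ hab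
        by_cases ha : a ∈ S
        · simp [heS a ha]
        · simp [hγ4 b a ha hab]
      · simp

end ArcGraph

/-! ### Kernel, functionals and integral surjectivity of the cycle matrix -/

section CycleBasis

variable {V A ι : Type*} [Fintype V] [DecidableEq V] [Fintype A] [Fintype ι]

omit [Fintype V] in
theorem IsIntegralCycleBasis.incidence_mulVec_row {I : PESP V A} {Γ : Matrix ι A ℤ}
    (hΓ : I.IsIntegralCycleBasis Γ) (k : ι) : I.incidence ℤ *ᵥ Γ k = 0 := (hΓ.oriented k).2

theorem IsIntegralCycleBasis.mulVec_transpose_incidence {I : PESP V A} {Γ : Matrix ι A ℤ}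
    (hΓ : I.IsIntegralCycleBasis Γ) (c : V → ℝ) :
    Γ.map (Int.cast : ℤ → ℝ) *ᵥ ((I.incidence ℝ)ᵀ *ᵥ c) = 0 := by
  ext k
  rw [incidence_transpose_mulVec]
  have := I.sum_incidence_mulVec_mul (fun a => (Γ k a : ℝ)) c
  rw [incidence_mulVec_intCast, hΓ.incidence_mulVec_row] at this
  simpa [Matrix.mulVec, dotProduct] using this.symm

theorem IsIntegralCycleBasis.exists_potential {I : PESP V A} {Γ : Matrix ι A ℤ}
    (hΓ : I.IsIntegralCycleBasis Γ) {x : A → ℝ} (hx : Γ.map (Int.cast : ℤ → ℝ) *ᵥ x = 0) :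
    ∃ c : V → ℝ, x = (I.incidence ℝ)ᵀ *ᵥ c := by
  obtain ⟨γ, hγ, -, h⟩ := I.exists_cycles_decomposition ℝ
  refine h x fun a => ?_
  have hmem : γ a ∈ Submodule.span ℤ (Set.range fun k => Γ k) := by
    rw [hΓ.span_eq]
    exact Submodule.subset_span (hγ a)
  generalize γ a = y at hmem
  induction hmem using Submodule.span_induction with
  | mem y hy =>
    obtain ⟨k, rfl⟩ := hy
    exact congrFun hx k
  | zero => simp
  | add y z _ _ hy hz => simp [add_mul, Finset.sum_add_distrib, hy, hz]
  | smul r y _ hy => simp [mul_assoc, ← Finset.mul_sum, hy]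

/-- The kernel of `Γ` consists of potential differences, and a circulation annihilates these; hence
it factors through `Γ`. This is the source of functionals that expose faces of cells. -/
theorem IsIntegralCycleBasis.exists_functional {I : PESP V A} {Γ : Matrix ι A ℤ}
    (hΓ : I.IsIntegralCycleBasis Γ) {h : A → ℝ} (hh : I.incidence ℝ *ᵥ h = 0) :
    ∃ g : (ι → ℝ) →ₗ[ℝ] ℝ, ∀ x, g (Γ.map (Int.cast : ℤ → ℝ) *ᵥ x) = ∑ a, h a * x a := by
  let φ : (A → ℝ) →ₗ[ℝ] ℝ := Fintype.linearCombination ℝ h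
  let G : (A → ℝ) →ₗ[ℝ] (ι → ℝ) := (Γ.map (Int.cast : ℤ → ℝ)).mulVecLin
  have hφ : φ ∈ G.ker.dualAnnihilator := by
    rw [Submodule.mem_dualAnnihilator]
    intro x hx
    obtain ⟨c, rfl⟩ := hΓ.exists_potential (x := x) hx
    have := I.sum_incidence_mulVec_mul h c
    rw [hh] at this
    simp only [φ, Fintype.linearCombination_apply, incidence_transpose_mulVec, smul_eq_mul]
    simpa [mul_comm] using this.symm
  rw [← LinearMap.range_dualMap_eq_dualAnnihilator_ker] at hφ
  obtain ⟨g, hg⟩ := hφ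
  refine ⟨g, fun x => ?_⟩
  have := LinearMap.congr_fun hg x
  simpa [φ, G, Fintype.linearCombination_apply, mul_comm] using this

/-- The rows form a ℤ-basis of the cycle space, so some functional `φ` takes the value `z k` on row
`k`. Each row is the combination of the fundamental cycles `γ a` with its own entries as
coefficients, so `p a = φ (γ a)` works. -/
theorem IsIntegralCycleBasis.exists_integer_preimage {I : PESP V A} {Γ : Matrix ι A ℤ}
    (hΓ : I.IsIntegralCycleBasis Γ) (z : ι → ℤ) : ∃ p : A → ℤ, Γ *ᵥ p = z := by
  obtain ⟨γ, hγ, hdec, -⟩ := I.exists_cycles_decomposition ℤ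
  have hrow : ∀ k, Γ k ∈ I.cycleSpace := fun k => Submodule.subset_span (hΓ.oriented k)
  let v : ι → I.cycleSpace := fun k => ⟨Γ k, hrow k⟩
  have hspan : ⊤ ≤ Submodule.span ℤ (Set.range v) := by
    rintro ⟨y, hy⟩ -
    have hy' := hy
    rw [← hΓ.span_eq, Submodule.mem_span_range_iff_exists_fun] at hy'
    obtain ⟨c, hc⟩ := hy'
    rw [Submodule.mem_span_range_iff_exists_fun]
    exact ⟨c, Subtype.ext (by simpa [v] using hc)⟩
  obtain ⟨φ, hφ⟩ : ∃ φ : I.cycleSpace →ₗ[ℤ] ℤ, ∀ k, φ (v k) = z k := by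
    have hli : LinearIndependent ℤ v := by
      let f : (ι → ℤ) →ₗ[ℤ] I.cycleSpace := Fintype.linearCombination ℤ v
      have hf : Function.Surjective f := by
        intro y
        have := hspan (Submodule.mem_top : y ∈ ⊤)
        rw [Submodule.mem_span_range_iff_exists_fun] at this
        obtain ⟨c, hc⟩ := this
        exact ⟨c, hc⟩
      -- As the number of rows equals the rank, generation becomes a surjective endomorphism of a
      -- finitely generated module, which is injective.
      let e : I.cycleSpace ≃ₗ[ℤ] (ι → ℤ) := LinearEquiv.ofFinrankEq _ _ (by simp [hΓ.card_eq])
      have hinj := OrzechProperty.injective_of_surjective_endomorphism (e.toLinearMap ∘ₗ f)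
        (e.surjective.comp hf)
      rw [Fintype.linearIndependent_iff]
      intro g hg
      have hg0 : f g = 0 := by simpa [f, Fintype.linearCombination_apply] using hg
      exact congrFun (hinj (a₁ := g) (a₂ := 0) (by simp [hg0]))
    exact ⟨(Module.Basis.mk hli hspan).constr ℤ z, fun k => by
      have := (Module.Basis.mk hli hspan).constr_basis ℤ z k
      rwa [Module.Basis.mk_apply] at this⟩
  have hγ' : ∀ a, γ a ∈ I.cycleSpace := fun a => Submodule.subset_span (hγ a)
  refine ⟨fun a => φ ⟨γ a, hγ' a⟩, ?_⟩
  ext k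
  have hk : v k = ∑ a, Γ k a • (⟨γ a, hγ' a⟩ : I.cycleSpace) := by
    refine Subtype.ext (funext fun b => ?_)
    rw [Submodule.coe_sum, Finset.sum_apply]
    simpa [v] using hdec (Γ k) (hΓ.incidence_mulVec_row k) b
  rw [← hφ k, hk, map_sum]
  simp only [map_smul, smul_eq_mul, Matrix.mulVec, dotProduct]

end CycleBasis

end PESP

namespace PESP

/-! ### Reachability from the root -/

section Reachability

variable {V A : Type*}

/-- Every vertex can be reached from `i` along arcs of `K`. -/
def ReachesAll (I : PESP V A) (K : Set (A ⊕ A)) (i : V) : Prop :=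
  ∀ v, Relation.ReflTransGen (fun x y => ∃ e ∈ K, I.barSrc e = x ∧ I.barTgt e = y) i v

theorem ReachesAll.mono {I : PESP V A} {K K' : Set (A ⊕ A)} {i : V} (h : I.ReachesAll K i)
    (hK : K ⊆ K') : I.ReachesAll K' i := fun v =>
  (h v).lift id fun _ _ ⟨e, he, h⟩ => ⟨e, hK he, h⟩

@[simp] theorem inl_mem_barArcs {L U : Set A} {a : A} : Sum.inl a ∈ barArcs L U ↔ a ∈ U := by
  simp [barArcs]

@[simp] theorem inr_mem_barArcs {L U : Set A} {a : A} : Sum.inr a ∈ barArcs L U ↔ a ∈ L := by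
  simp [barArcs]

theorem barArcs_mono {L U L' U' : Set A} (hL : L ⊆ L') (hU : U ⊆ U') :
    barArcs L U ⊆ barArcs L' U' := by
  rintro (a | a) ha
  · exact inl_mem_barArcs.2 (hU (inl_mem_barArcs.1 ha))
  · exact inr_mem_barArcs.2 (hL (inr_mem_barArcs.1 ha))

theorem arcGraph_adj_of_mem {I : PESP V A} {L U : Set A} {e : A ⊕ A} (he : e ∈ barArcs L U) :
    (arcGraph I.src I.tgt (L ∪ U)).Adj (I.barSrc e) (I.barTgt e) := by
  rw [arcGraph_adj_iff]
  rcases e with a | a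
  · exact ⟨I.no_loop a, a, Or.inr (inl_mem_barArcs.1 he), Or.inl ⟨rfl, rfl⟩⟩
  · exact ⟨(I.no_loop a).symm, a, Or.inl (inr_mem_barArcs.1 he), Or.inr ⟨rfl, rfl⟩⟩

theorem ReachesAll.connected {I : PESP V A} {L U : Set A} {i : V}
    (h : I.ReachesAll (barArcs L U) i) : (arcGraph I.src I.tgt (L ∪ U)).Connected := by
  have key : ∀ v, (arcGraph I.src I.tgt (L ∪ U)).Reachable i v := by
    intro v
    induction h v with
    | refl => rfl
    | tail _ hbc ih =>
      obtain ⟨e, he, rfl, rfl⟩ := hbc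
      exact ih.trans (arcGraph_adj_of_mem he).reachable
  have : Nonempty V := ⟨i⟩
  exact ⟨fun v w => (key v).symm.trans (key w)⟩

theorem reachesAll_univ (I : PESP V A) (i : V) : I.ReachesAll Set.univ i := by
  intro v
  obtain ⟨p⟩ := I.connected i v
  induction p with
  | nil => rfl
  | cons hadj _ ih =>
    refine Relation.ReflTransGen.head ?_ ih
    obtain ⟨-, a, -, ⟨rfl, rfl⟩ | ⟨rfl, rfl⟩⟩ := arcGraph_adj_iff.1 hadj
    · exact ⟨Sum.inl a, trivial, rfl, rfl⟩
    · exact ⟨Sum.inr a, trivial, rfl, rfl⟩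

/-- Along the arcs of `K`, a function that does not decrease is minimal at the root. -/
theorem ReachesAll.le {I : PESP V A} {K : Set (A ⊕ A)} {i : V} (h : I.ReachesAll K i)
    {c : V → ℝ} (hc : ∀ e ∈ K, c (I.barSrc e) ≤ c (I.barTgt e)) (v : V) : c i ≤ c v := by
  induction h v with
  | refl => exact le_rfl
  | tail _ hbc ih =>
    obtain ⟨e, he, rfl, rfl⟩ := hbc
    exact ih.trans (hc e he)

/-- The cut form of reachability, applied to the set `W` of unreachable vertices. -/
theorem reachesAll_of_forall {I : PESP V A} {K : Set (A ⊕ A)} {i : V}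
    (h : ∀ W : Set V, i ∉ W → (∀ e ∈ K, I.barSrc e ∉ W → I.barTgt e ∉ W) → W = ∅) :
    I.ReachesAll K i := by
  intro v
  by_contra hv
  have := h {v | ¬ Relation.ReflTransGen
    (fun x y => ∃ e ∈ K, I.barSrc e = x ∧ I.barTgt e = y) i v} (by simp [Relation.ReflTransGen.refl])
    (by
      intro e he hs
      simp only [Set.mem_ofPred_eq, not_not] at hs ⊢
      exact hs.tail ⟨e, he, rfl, rfl⟩)
  exact (Set.eq_empty_iff_forall_notMem.1 this v) hv

end Reachability

/-! ### Flows from the root and their divergences -/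

section Flows

variable {V A : Type*} [Fintype V] [DecidableEq V] [Fintype A]

omit [Fintype V] in
theorem ReachesAll.exists_path_flow {I : PESP V A} {K : Set (A ⊕ A)} {i : V}
    (h : I.ReachesAll K i) (v : V) :
    ∃ g : A ⊕ A → ℝ, (∀ e, 0 ≤ g e) ∧ (∀ e ∉ K, g e = 0) ∧
      I.incidence ℝ *ᵥ (fun a => g (Sum.inl a) - g (Sum.inr a)) =
        Pi.single i 1 - Pi.single v 1 := by
  classical
  induction h v with
  | refl =>
    refine ⟨0, by simp, by simp, ?_⟩
    have : (fun a : A => (0 : A ⊕ A → ℝ) (Sum.inl a) - (0 : A ⊕ A → ℝ) (Sum.inr a)) = 0 := by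
      ext; simp
    rw [this]
    simp
  | tail _ hbc ih =>
    obtain ⟨e, he, rfl, rfl⟩ := hbc
    obtain ⟨g, h1, h2, h3⟩ := ih
    refine ⟨g + Pi.single e 1, fun e' => ?_, fun e' he' => ?_, ?_⟩
    · refine add_nonneg (h1 e') ?_
      rw [Pi.single_apply]
      split_ifs <;> norm_num
    · have : e' ≠ e := fun h => he' (h ▸ he)
      simp [h2 e' he', this]
    · have hsplit : (fun a : A => (g + Pi.single e (1 : ℝ) : A ⊕ A → ℝ) (Sum.inl a) -
          (g + Pi.single e (1 : ℝ) : A ⊕ A → ℝ) (Sum.inr a)) =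
          (fun a => g (Sum.inl a) - g (Sum.inr a)) +
          (Sum.elim (fun a => Pi.single a 1) (fun a => -Pi.single a 1) e : A → ℝ) := by
        ext a
        rcases e with b | b <;> simp [Pi.single_apply] <;> ring
      rw [hsplit, Matrix.mulVec_add, h3]
      rcases e with b | b
      · simp only [Sum.elim_inl, incidence_mulVec_single, barSrc, barTgt]
        abel
      · simp only [Sum.elim_inr, Matrix.mulVec_neg, incidence_mulVec_single, barSrc, barTgt]
        abel

/-- Every supply vector of total zero is the divergence of a vector supported on `K`. -/
theorem ReachesAll.exists_divergence_eq {I : PESP V A} {L U : Set A} {i : V}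
    (h : I.ReachesAll (barArcs L U) i) (d : V → ℝ) (hd : ∑ v, d v = 0) :
    ∃ f : A → ℝ, (∀ a, a ∉ L → a ∉ U → f a = 0) ∧ I.incidence ℝ *ᵥ f = d := by
  choose g _ h2 h3 using h.exists_path_flow
  -- The path flow to `v` has divergence $e_i-e_v$, so weights `-d v` produce `d`, and the
  -- contributions at `i` cancel because `d` has total zero.
  refine ⟨∑ v, (-d v) • fun a => g v (Sum.inl a) - g v (Sum.inr a), fun a hL hU => ?_, ?_⟩
  · rw [Finset.sum_apply]
    refine Finset.sum_eq_zero fun v _ => ?_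
    simp [h2 v (Sum.inl a) (by simpa), h2 v (Sum.inr a) (by simpa)]
  · rw [Matrix.mulVec_sum]
    simp only [Matrix.mulVec_smul, h3]
    ext w
    simp [Finset.sum_apply, mul_sub, Finset.sum_sub_distrib, hd,
      Pi.single_apply]

theorem ReachesAll.exists_positive_flow {I : PESP V A} {K : Set (A ⊕ A)} {i : V}
    (h : I.ReachesAll K i) :
    ∃ g : A ⊕ A → ℝ, (∀ e ∈ K, 0 < g e) ∧ (∀ e ∉ K, g e = 0) ∧
      ∀ j ≠ i, (I.incidence ℝ *ᵥ fun a => g (Sum.inl a) - g (Sum.inr a)) j < 0 := by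
  classical
  choose g h1 h2 h3 using h.exists_path_flow
  let q : A ⊕ A → ℝ := fun e => if e ∈ K then 1 else 0
  let d : V → ℝ := I.incidence ℝ *ᵥ fun a => q (Sum.inl a) - q (Sum.inr a)
  -- A unit flow `q` on `K` secures positivity on each arc, and `N` exceeds its divergence
  -- everywhere. Adding `N` units of path flow to each vertex then makes all divergences away from
  -- `i` negative.
  let N : ℝ := 1 + ∑ j, |d j|
  have hN : 0 ≤ N := by positivity
  have hdN : ∀ j, d j < N := fun j => by
    have := Finset.single_le_sum (f := fun j => |d j|) (fun j _ => abs_nonneg _)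
      (Finset.mem_univ j)
    have := le_abs_self (d j)
    simp only [N]
    linarith
  refine ⟨fun e => N * ∑ v, g v e + q e, fun e he => ?_, fun e he => ?_, fun j hj => ?_⟩
  · have : 0 ≤ N * ∑ v, g v e := mul_nonneg hN (Finset.sum_nonneg fun v _ => h1 v e)
    simp only [q, he, if_true]
    linarith
  · simp [q, he, h2 _ e he]
  · have hsplit : (fun a : A => (N * ∑ v, g v (Sum.inl a) + q (Sum.inl a)) -
        (N * ∑ v, g v (Sum.inr a) + q (Sum.inr a))) =
        N • (∑ v, fun a => g v (Sum.inl a) - g v (Sum.inr a)) +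
        fun a => q (Sum.inl a) - q (Sum.inr a) := by
      ext a
      simp [Finset.sum_apply, Finset.sum_sub_distrib]
      ring
    rw [hsplit, Matrix.mulVec_add, Matrix.mulVec_smul, Matrix.mulVec_sum]
    simp only [h3]
    have hs : (∑ v, (Pi.single i (1 : ℝ) - Pi.single v 1 : V → ℝ)) j = -1 := by
      simp [Finset.sum_apply, Pi.single_apply, hj]
    have := hdN j
    simp only [Pi.add_apply, Pi.smul_apply, hs, smul_eq_mul]
    change N * -1 + d j < 0
    linarith

/-- Forward and backward flow on the same arc cannot cancel, since `L` and `U` are disjoint. -/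
theorem ReachesAll.exists_sign_vector {I : PESP V A} {L U : Set A} {i : V}
    (h : I.ReachesAll (barArcs L U) i) (hLU : L ∩ U = ∅) :
    ∃ f : A → ℝ, (∀ a, f a < 0 ↔ a ∈ L) ∧ (∀ a, 0 < f a ↔ a ∈ U) ∧
      ∀ j ≠ i, (I.incidence ℝ *ᵥ f) j < 0 := by
  obtain ⟨g, h1, h2, h3⟩ := h.exists_positive_flow
  have hL : ∀ a, (a ∈ L ∧ 0 < g (Sum.inr a)) ∨ (a ∉ L ∧ g (Sum.inr a) = 0) := fun a => by
    by_cases ha : a ∈ L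
    · exact Or.inl ⟨ha, h1 _ (by simpa)⟩
    · exact Or.inr ⟨ha, h2 _ (by simpa)⟩
  have hU : ∀ a, (a ∈ U ∧ 0 < g (Sum.inl a)) ∨ (a ∉ U ∧ g (Sum.inl a) = 0) := fun a => by
    by_cases ha : a ∈ U
    · exact Or.inl ⟨ha, h1 _ (by simpa)⟩
    · exact Or.inr ⟨ha, h2 _ (by simpa)⟩
  have hdis : ∀ a, ¬ (a ∈ L ∧ a ∈ U) := fun a ha => by
    simpa [hLU] using (show a ∈ L ∩ U from ha)
  refine ⟨_, fun a => ?_, fun a => ?_, h3⟩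
  all_goals
    have h := hdis a
    rcases hL a with ⟨h1, h2⟩ | ⟨h1, h2⟩ <;> rcases hU a with ⟨h3, h4⟩ | ⟨h3, h4⟩
    · exact (h ⟨h1, h3⟩).elim
    all_goals
      simp only [h1, h3, iff_true, iff_false, not_lt]
      linarith

/-- The sum of the divergences over `W` is the net flow that leaves `W`. -/
theorem sum_divergence_indicator (I : PESP V A) (f : A → ℝ) (W : Set V) :
    ∑ v, (I.incidence ℝ *ᵥ f) v * W.indicator 1 v =
      ∑ a, f a * (W.indicator 1 (I.src a) - W.indicator 1 (I.tgt a)) :=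
  I.sum_incidence_mulVec_mul f _

theorem sum_divergence_neg {I : PESP V A} {f : A → ℝ} {i : V}
    (h : ∀ j ≠ i, (I.incidence ℝ *ᵥ f) j < 0) {W : Set V} (hi : i ∉ W) (hW : W.Nonempty) :
    ∑ v, (I.incidence ℝ *ᵥ f) v * W.indicator 1 v < 0 := by
  obtain ⟨w, hw⟩ := hW
  have hne : ∀ v ∈ W, v ≠ i := fun v hv hvi => hi (hvi ▸ hv)
  refine Finset.sum_neg' (fun v _ => ?_) ⟨w, Finset.mem_univ _, ?_⟩
  · by_cases hv : v ∈ W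
    · simpa [hv] using (h v (hne v hv)).le
    · simp [hv]
  · simpa [hw] using h w (hne w hw)

/-- If no arc used in its flow direction enters `W`, the net flow out of `W` is nonnegative; but
negative divergences make it negative when `W` is non-empty and avoids `i`. -/
theorem reachesAll_of_divergence_neg {I : PESP V A} {f : A → ℝ} {i : V}
    (h : ∀ j ≠ i, (I.incidence ℝ *ᵥ f) j < 0) :
    I.ReachesAll (barArcs {a | f a < 0} {a | 0 < f a}) i := by
  refine reachesAll_of_forall fun W hi hW => ?_
  by_contra hne
  have hneg := sum_divergence_neg h hi (Set.nonempty_iff_ne_empty.2 hne)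
  rw [sum_divergence_indicator] at hneg
  refine absurd hneg (not_lt.2 (Finset.sum_nonneg fun a _ => ?_))
  by_cases hs : I.src a ∈ W <;> by_cases ht : I.tgt a ∈ W
  · simp [hs, ht]
  · have : ¬ f a < 0 := fun hf => hW (Sum.inr a) (by simpa) ht hs
    simpa [hs, ht] using this
  · have : ¬ 0 < f a := fun hf => hW (Sum.inl a) (by simpa) hs ht
    simpa [hs, ht] using this
  · simp [hs, ht]

end Flows

end PESP

namespace PESP

/-! ### Faces of the cube -/

section CubeFaces

variable {V A ι : Type*}

theorem cubeFace_subset_cube (I : PESP V A) (L U : Set A) : I.cubeFace L U ⊆ I.cube :=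
  fun _ hx => hx.1

theorem cubeFace_empty (I : PESP V A) : I.cubeFace ∅ ∅ = I.cube := by
  ext x
  simp [cubeFace]

theorem cubeFace_anti (I : PESP V A) {L U L' U' : Set A} (hL : L ⊆ L') (hU : U ⊆ U') :
    I.cubeFace L' U' ⊆ I.cubeFace L U :=
  fun _ hx => ⟨hx.1, fun a ha => hx.2.1 a (hL ha), fun a ha => hx.2.2 a (hU ha)⟩

theorem cubeFace_inter (I : PESP V A) (L U L' U' : Set A) :
    I.cubeFace L U ∩ I.cubeFace L' U' = I.cubeFace (L ∪ L') (U ∪ U') := by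
  ext x
  simp only [cubeFace, Set.mem_inter_iff, Set.mem_ofPred_eq, Set.mem_union]
  constructor
  · rintro ⟨⟨h1, h2, h3⟩, -, h5, h6⟩
    exact ⟨h1, fun a ha => ha.elim (h2 a) (h5 a), fun a ha => ha.elim (h3 a) (h6 a)⟩
  · rintro ⟨h1, h2, h3⟩
    exact ⟨⟨h1, fun a ha => h2 a (Or.inl ha), fun a ha => h3 a (Or.inl ha)⟩,
      h1, fun a ha => h2 a (Or.inr ha), fun a ha => h3 a (Or.inr ha)⟩

theorem cubeFace_nonempty (I : PESP V A) {L U : Set A} (hLU : L ∩ U = ∅) :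
    (I.cubeFace L U).Nonempty := by
  classical
  refine ⟨fun a => if a ∈ U then I.u a else I.l a, fun a => ?_, fun a ha => ?_, fun a ha => ?_⟩
  · have := I.l_le_u a
    dsimp only
    split_ifs
    · exact ⟨this, le_rfl⟩
    · exact ⟨le_rfl, this⟩
  · have : a ∉ U := fun h => by simpa [hLU] using (show a ∈ L ∩ U from ⟨ha, h⟩)
    simp [this]
  · simp [ha]

theorem inter_eq_empty_of_nonempty_cubeFace {I : PESP V A} (hfree : ∀ a, I.l a < I.u a)
    {L U : Set A} (h : (I.cubeFace L U).Nonempty) : L ∩ U = ∅ := by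
  obtain ⟨x, -, hL, hU⟩ := h
  refine Set.eq_empty_iff_forall_notMem.2 fun a ha => ?_
  have := hfree a
  rw [← hL a ha.1, ← hU a ha.2] at this
  exact lt_irrefl _ this

theorem cubeFace_eq_pi (I : PESP V A) {L U : Set A} (hLU : L ∩ U = ∅) :
    ∃ lo hi : A → ℝ, lo ≤ hi ∧ I.cubeFace L U = Set.univ.pi fun a => Set.Icc (lo a) (hi a) := by
  classical
  have hdis : ∀ a ∈ L, a ∉ U := fun a ha h => by
    simpa [hLU] using (show a ∈ L ∩ U from ⟨ha, h⟩)
  refine ⟨fun a => if a ∈ U then I.u a else I.l a, fun a => if a ∈ L then I.l a else I.u a,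
    fun a => ?_, ?_⟩
  · have := I.l_le_u a
    by_cases h1 : a ∈ L
    · simp [h1, hdis a h1]
    · by_cases h2 : a ∈ U <;> simp [h1, h2, this]
  · ext x
    simp only [cubeFace, cube, Set.mem_ofPred_eq, Set.mem_pi, Set.mem_univ, true_imp_iff,
      Set.mem_Icc]
    constructor
    · rintro ⟨h1, h2, h3⟩ a
      have := h1 a
      split_ifs with hU hL hL
      · exact absurd hU (hdis a hL)
      · exact ⟨(h3 a hU).ge, this.2⟩
      · exact ⟨this.1, (h2 a hL).le⟩
      · exact this
    · intro h
      refine ⟨fun a => ?_, fun a ha => ?_, fun a ha => ?_⟩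
      · have h1 := h a
        have := I.l_le_u a
        split_ifs at h1 with hU hL hL <;> constructor <;> linarith
      · have h1 := h a
        simp only [ha, hdis a ha, if_true, if_false] at h1
        exact le_antisymm h1.2 h1.1
      · have h1 := h a
        have hL : a ∉ L := fun hL => hdis a hL ha
        simp only [ha, hL, if_true, if_false] at h1
        exact le_antisymm h1.2 h1.1

theorem isPolytope_cubeFace [Finite A] (I : PESP V A) {L U : Set A} (hLU : L ∩ U = ∅) :
    ∃ s : Finset (A → ℝ), I.cubeFace L U = convexHull ℝ (s : Set (A → ℝ)) := by
  obtain ⟨lo, hi, hle, heq⟩ := I.cubeFace_eq_pi hLU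
  have hfin : (Set.univ.pi fun a => ({lo a, hi a} : Set ℝ)).Finite :=
    Set.Finite.pi fun a => Set.toFinite _
  refine ⟨hfin.toFinset, ?_⟩
  rw [heq, Set.Finite.coe_toFinset, convexHull_pi]
  refine congrArg _ (funext fun a => ?_)
  rw [convexHull_pair, segment_eq_Icc (hle a)]

theorem isCompact_cube (I : PESP V A) : IsCompact I.cube := by
  have : I.cube = Set.univ.pi fun a => Set.Icc (I.l a) (I.u a) := by
    ext x
    simp [cube, Pi.le_def, forall_and]
  rw [this]
  exact isCompact_univ_pi fun a => isCompact_Icc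

/-- The face of `F_{L,U}` on which a linear functional is maximal. -/
theorem setOf_forall_le_cubeFace [Fintype A] (I : PESP V A) {L U : Set A} (hLU : L ∩ U = ∅)
    (f : A → ℝ) :
    {x ∈ I.cubeFace L U | ∀ y ∈ I.cubeFace L U, ∑ a, f a * y a ≤ ∑ a, f a * x a} =
      I.cubeFace (L ∪ {a | a ∉ U ∧ f a < 0}) (U ∪ {a | a ∉ L ∧ 0 < f a}) := by
  classical
  -- Optimality is tested by moving one free coordinate at a time to the bound favoured by the sign
  -- of `f`.
  have hupd : ∀ x ∈ I.cubeFace L U, ∀ a ∉ L, a ∉ U → ∀ r, I.l a ≤ r → r ≤ I.u a →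
      Function.update x a r ∈ I.cubeFace L U := by
    intro x hx a hL hU r h1 h2
    refine ⟨fun b => ?_, fun b hb => ?_, fun b hb => ?_⟩
    · by_cases hba : b = a
      · subst hba
        simpa using ⟨h1, h2⟩
      · simpa [hba] using hx.1 b
    · have hba : b ≠ a := fun h => hL (h ▸ hb)
      simpa [hba] using hx.2.1 b hb
    · have hba : b ≠ a := fun h => hU (h ▸ hb)
      simpa [hba] using hx.2.2 b hb
  have hsum : ∀ (x : A → ℝ) a r, ∑ b, f b * Function.update x a r b =
      ∑ b, f b * x b + f a * (r - x a) := by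
    intro x a r
    have : ∀ b, f b * Function.update x a r b =
        f b * x b + if b = a then f a * (r - x a) else 0 := by
      intro b
      by_cases hba : b = a
      · subst hba
        simp
        ring
      · simp [hba]
    simp [this, Finset.sum_add_distrib]
  have hdis : ∀ a ∈ L, a ∉ U := fun a ha h => by
    simpa [hLU] using (show a ∈ L ∩ U from ⟨ha, h⟩)
  ext x
  constructor
  · rintro ⟨hx, hmax⟩
    refine ⟨hx.1, ?_, ?_⟩
    · rintro a (ha | ⟨haU, ha⟩)
      · exact hx.2.1 a ha
      · by_cases haL : a ∈ L
        · exact hx.2.1 a haL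
        have h1 := hmax _ (hupd x hx a haL haU (I.l a) le_rfl (I.l_le_u a))
        rw [hsum] at h1
        have h2 := (hx.1 a).1
        nlinarith
    · rintro a (ha | ⟨haL, ha⟩)
      · exact hx.2.2 a ha
      · by_cases haU : a ∈ U
        · exact hx.2.2 a haU
        have h1 := hmax _ (hupd x hx a haL haU (I.u a) (I.l_le_u a) le_rfl)
        rw [hsum] at h1
        have h2 := (hx.1 a).2
        nlinarith
  · intro hx
    have hx' : x ∈ I.cubeFace L U :=
      I.cubeFace_anti Set.subset_union_left Set.subset_union_left hx
    refine ⟨hx', fun y hy => Finset.sum_le_sum fun a _ => ?_⟩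
    by_cases haL : a ∈ L
    · rw [hx'.2.1 a haL, hy.2.1 a haL]
    by_cases haU : a ∈ U
    · rw [hx'.2.2 a haU, hy.2.2 a haU]
    rcases lt_trichotomy (f a) 0 with h | h | h
    · rw [hx.2.1 a (Or.inr ⟨haU, h⟩)]
      exact mul_le_mul_of_nonpos_left (hy.1 a).1 h.le
    · simp [h]
    · rw [hx.2.2 a (Or.inr ⟨haL, h⟩)]
      exact mul_le_mul_of_nonneg_left (hy.1 a).2 h.le

/-- The face of the cube on which a linear functional is maximal. -/
theorem setOf_forall_le_cube [Fintype A] (I : PESP V A) (f : A → ℝ) :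
    {x ∈ I.cube | ∀ y ∈ I.cube, ∑ a, f a * y a ≤ ∑ a, f a * x a} =
      I.cubeFace {a | f a < 0} {a | 0 < f a} := by
  have := I.setOf_forall_le_cubeFace (L := ∅) (U := ∅) (by simp) f
  simpa [cubeFace_empty] using this

end CubeFaces

/-! ### Bounded faces of $P_i$ -/

section BoundedFaces

variable {V A ι : Type*} [Fintype V] [DecidableEq V]

theorem cube_subset_coneSum (I : PESP V A) (i : V) : I.cube ⊆ I.coneSum i :=
  fun x hx => ⟨x, hx, 0, ⟨0, by simp, rfl, by simp⟩, by simp⟩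

theorem eq_of_incidence_transpose_mulVec_eq_zero {I : PESP V A} {c : V → ℝ}
    (h : (I.incidence ℝ)ᵀ *ᵥ c = 0) (v w : V) : c v = c w := by
  rw [incidence_transpose_mulVec] at h
  refine eq_of_arcGraph_reachable (S := Set.univ) (src := I.src) (tgt := I.tgt) (fun a _ => ?_)
    (I.connected v w)
  exact sub_eq_zero.1 (congrFun h a)

variable [Fintype A]

theorem map_eq_sum_mul (φ : (A → ℝ) →ₗ[ℝ] ℝ) [DecidableEq A] (x : A → ℝ) :
    φ x = ∑ a, φ (Pi.single a 1) * x a := by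
  conv_lhs => rw [← Finset.univ_sum_single x, map_sum]
  refine Finset.sum_congr rfl fun a _ => ?_
  have : (Pi.single a (x a) : A → ℝ) = x a • Pi.single a 1 := by
    rw [← Pi.single_smul]
    simp
  rw [this, map_smul, smul_eq_mul, mul_comm]

theorem sum_mul_incidence_transpose_mulVec (I : PESP V A) (f : A → ℝ) (c : V → ℝ) :
    ∑ a, f a * ((I.incidence ℝ)ᵀ *ᵥ c) a = ∑ v, (I.incidence ℝ *ᵥ f) v * c v := by
  rw [sum_incidence_mulVec_mul, incidence_transpose_mulVec]

/-- A functional that decreases strictly along the generators of the cone is maximal over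
`coneSum` exactly where it is maximal over the cube. -/
theorem setOf_forall_le_coneSum (I : PESP V A) {i : V} {f : A → ℝ}
    (hf : ∀ j ≠ i, (I.incidence ℝ *ᵥ f) j < 0) :
    {x ∈ I.coneSum i | ∀ y ∈ I.coneSum i, ∑ a, f a * y a ≤ ∑ a, f a * x a} =
      I.cubeFace {a | f a < 0} {a | 0 < f a} := by
  have hle : ∀ c : V → ℝ, (∀ j, 0 ≤ c j) → c i = 0 → ∀ v, (I.incidence ℝ *ᵥ f) v * c v ≤ 0 := by
    intro c hc hci v
    by_cases hv : v = i
    · simp [hv, hci]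
    · exact mul_nonpos_of_nonpos_of_nonneg (hf v hv).le (hc v)
  rw [← setOf_forall_le_cube]
  ext x
  constructor
  · rintro ⟨⟨x, hx, _, ⟨c, hc, hci, rfl⟩, rfl⟩, hmax⟩
    have h1 := hmax x (I.cube_subset_coneSum i hx)
    simp only [Pi.add_apply, mul_add, Finset.sum_add_distrib,
      sum_mul_incidence_transpose_mulVec] at h1
    have h0 : ∑ v, (I.incidence ℝ *ᵥ f) v * c v = 0 :=
      le_antisymm (Finset.sum_nonpos fun v _ => hle c hc hci v) (by linarith)
    have hc0 : c = 0 := by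
      ext v
      by_cases hv : v = i
      · simp [hv, hci]
      · have := (Finset.sum_eq_zero_iff_of_nonpos fun v _ => hle c hc hci v).1 h0 v
          (Finset.mem_univ v)
        exact (mul_eq_zero.1 this).resolve_left (hf v hv).ne
    subst hc0
    simp only [Matrix.mulVec_zero, add_zero] at hmax ⊢
    exact ⟨hx, fun y hy => hmax y (I.cube_subset_coneSum i hy)⟩
  · rintro ⟨hx, hmax⟩
    refine ⟨I.cube_subset_coneSum i hx, ?_⟩
    rintro _ ⟨y, hy, _, ⟨c, hc, hci, rfl⟩, rfl⟩
    simp only [Pi.add_apply, mul_add, Finset.sum_add_distrib,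
      sum_mul_incidence_transpose_mulVec]
    have := Finset.sum_nonpos fun v (_ : v ∈ Finset.univ) => hle c hc hci v
    linarith [hmax y hy]

theorem isFaceOf_coneSum_cubeFace {I : PESP V A} {i : V} {L U : Set A} (hLU : L ∩ U = ∅)
    (h : I.ReachesAll (barArcs L U) i) : IsFaceOf (I.coneSum i) (I.cubeFace L U) := by
  classical
  refine ⟨I.cubeFace_nonempty hLU, fun _ => ?_⟩
  obtain ⟨f, hL, hU, hf⟩ := h.exists_sign_vector hLU
  refine ⟨LinearMap.toContinuousLinearMap (Fintype.linearCombination ℝ f), ?_⟩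
  have := I.setOf_forall_le_coneSum hf
  simp only [hL, hU, Set.ofPred_mem_eq] at this
  rw [← this]
  simp [Fintype.linearCombination_apply, mul_comm]

theorem exists_eq_cubeFace_of_isFaceOf_coneSum {I : PESP V A} {i : V} {F : Set (A → ℝ)}
    (hF : IsFaceOf (I.coneSum i) F) (hb : Bornology.IsBounded F) :
    ∃ L U : Set A, L ∩ U = ∅ ∧ I.ReachesAll (barArcs L U) i ∧ F = I.cubeFace L U := by
  classical
  obtain ⟨⟨x, hx⟩, hexp⟩ := hF
  obtain ⟨φ, rfl⟩ := hexp ⟨x, hx⟩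
  let f : A → ℝ := fun a => φ (Pi.single a 1)
  have hφ : ∀ y, φ y = ∑ a, f a * y a := map_eq_sum_mul φ.toLinearMap
  have hφB : ∀ c, φ ((I.incidence ℝ)ᵀ *ᵥ c) = ∑ v, (I.incidence ℝ *ᵥ f) v * c v := fun c => by
    rw [hφ, sum_mul_incidence_transpose_mulVec]
  have hray : ∀ j ≠ i, ∀ t : ℝ, 0 ≤ t →
      x + t • ((I.incidence ℝ)ᵀ *ᵥ Pi.single j 1) ∈ I.coneSum i := by
    intro j hj t ht
    obtain ⟨y, hy, _, ⟨c, hc, hci, rfl⟩, rfl⟩ := hx.1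
    refine ⟨y, hy, _, ⟨c + t • Pi.single j 1, fun v => ?_, ?_, rfl⟩, ?_⟩
    · have h1 : 0 ≤ (Pi.single j (1 : ℝ) : V → ℝ) v := by
        rw [Pi.single_apply]
        split_ifs <;> norm_num
      exact add_nonneg (hc v) (mul_nonneg ht h1)
    · simp [hci, hj.symm]
    · simp only [Matrix.mulVec_add, Matrix.mulVec_smul, add_assoc]
  have hneg : ∀ j ≠ i, (I.incidence ℝ *ᵥ f) j < 0 := by
    intro j hj
    have hval : φ ((I.incidence ℝ)ᵀ *ᵥ Pi.single j 1) = (I.incidence ℝ *ᵥ f) j := by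
      rw [hφB]
      simp [Pi.single_apply]
    refine lt_of_le_of_ne ?_ fun h0 => ?_
    · have := hx.2 _ (hray j hj 1 zero_le_one)
      rw [map_add, one_smul, hval] at this
      linarith
    -- With divergence zero at `j` the whole ray from `x` stays in the face. The multiple below
    -- moves `x` by `r + ‖x‖ + 1`, further than the bound `r` on the face permits.
    · obtain ⟨r, hr⟩ := hb.exists_norm_le
      have hne : (I.incidence ℝ)ᵀ *ᵥ Pi.single j (1 : ℝ) ≠ 0 := fun h => by
        have := eq_of_incidence_transpose_mulVec_eq_zero h j i
        simp [hj.symm] at this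
      have hpos := norm_pos_iff.2 hne
      have hxr : ‖x‖ ≤ r := hr x hx
      have hr0 : 0 ≤ r := (norm_nonneg x).trans hxr
      have ht : 0 ≤ (r + ‖x‖ + 1) / ‖(I.incidence ℝ)ᵀ *ᵥ Pi.single j (1 : ℝ)‖ := by positivity
      have h1 := hr _ ⟨hray j hj _ ht, fun y hy => by
        rw [map_add, map_smul, hval, h0, smul_zero, add_zero]
        exact hx.2 y hy⟩
      have h2 := norm_sub_le (x + ((r + ‖x‖ + 1) / ‖(I.incidence ℝ)ᵀ *ᵥ Pi.single j (1 : ℝ)‖) •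
        ((I.incidence ℝ)ᵀ *ᵥ Pi.single j 1)) x
      rw [add_sub_cancel_left, norm_smul, Real.norm_of_nonneg ht,
        div_mul_cancel₀ _ hpos.ne'] at h2
      linarith
  refine ⟨{a | f a < 0}, {a | 0 < f a}, ?_, reachesAll_of_divergence_neg hneg, ?_⟩
  · ext a
    simpa using fun h : f a < 0 => h.le
  · rw [← I.setOf_forall_le_coneSum hneg]
    simp only [hφ]

/-- The combinatorial description of cells; the geometry of $P_i$ is not needed to establish the
tiling beyond this point. -/
theorem mem_inducedCells_iff {I : PESP V A} {Γ : Matrix ι A ℤ} {i : V} {C : Set (ι → ℝ)} :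
    C ∈ I.inducedCells Γ i ↔ ∃ L U : Set A, L ∩ U = ∅ ∧ I.ReachesAll (barArcs L U) i ∧
      C = I.offsetMap Γ '' I.cubeFace L U := by
  constructor
  · rintro ⟨F, hF, hb, rfl⟩
    obtain ⟨L, U, h1, h2, rfl⟩ := exists_eq_cubeFace_of_isFaceOf_coneSum hF hb
    exact ⟨L, U, h1, h2, rfl⟩
  · rintro ⟨L, U, h1, h2, rfl⟩
    exact ⟨_, isFaceOf_coneSum_cubeFace h1 h2,
      I.isCompact_cube.isBounded.subset (I.cubeFace_subset_cube L U), rfl⟩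

end BoundedFaces

end PESP

namespace PESP

/-! ### The fine zonotopal tiling -/

section Offset

variable {V A ι : Type*} [Fintype A]

/-- The map `x ↦ Γ x / T` as a linear map. -/
noncomputable def offsetLinear (I : PESP V A) (Γ : Matrix ι A ℤ) : (A → ℝ) →ₗ[ℝ] (ι → ℝ) :=
  (I.T : ℝ)⁻¹ • (Γ.map (Int.cast : ℤ → ℝ)).mulVecLin

theorem coe_offsetLinear (I : PESP V A) (Γ : Matrix ι A ℤ) :
    ⇑(I.offsetLinear Γ) = I.offsetMap Γ := rfl

omit [Fintype A] in
theorem T_ne_zero (I : PESP V A) : (I.T : ℝ) ≠ 0 := Nat.cast_ne_zero.2 I.T_pos.ne'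

theorem offsetMap_eq_iff (I : PESP V A) (Γ : Matrix ι A ℤ) (x : A → ℝ) (z : ι → ℝ) :
    I.offsetMap Γ x = z ↔ Γ.map (Int.cast : ℤ → ℝ) *ᵥ x = (I.T : ℝ) • z :=
  inv_smul_eq_iff₀ I.T_ne_zero

theorem offsetMap_image_cube (I : PESP V A) (Γ : Matrix ι A ℤ) :
    I.offsetMap Γ '' I.cube = I.offsetZonotope Γ := by
  ext z
  constructor
  · rintro ⟨x, hx, h⟩
    exact ⟨x, (I.offsetMap_eq_iff Γ x z).1 h, hx⟩
  · rintro ⟨x, h, hx⟩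
    exact ⟨x, hx, (I.offsetMap_eq_iff Γ x z).2 h⟩

variable [Fintype V] [DecidableEq V] [Fintype ι]

theorem IsIntegralCycleBasis.offsetMap_eq_offsetMap {I : PESP V A} {Γ : Matrix ι A ℤ}
    (hΓ : I.IsIntegralCycleBasis Γ) {x y : A → ℝ} :
    I.offsetMap Γ x = I.offsetMap Γ y ↔
      ∃ c : V → ℝ, ∀ a, x a - y a = c (I.src a) - c (I.tgt a) := by
  rw [offsetMap_eq_iff, ← (I.offsetMap_eq_iff Γ y _).1 rfl, ← sub_eq_zero, ← Matrix.mulVec_sub]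
  constructor
  · intro h
    obtain ⟨c, hc⟩ := hΓ.exists_potential h
    rw [incidence_transpose_mulVec] at hc
    exact ⟨c, congrFun hc⟩
  · rintro ⟨c, hc⟩
    have : x - y = (I.incidence ℝ)ᵀ *ᵥ c := by
      rw [incidence_transpose_mulVec]
      exact funext hc
    rw [this, hΓ.mulVec_transpose_incidence]

omit [Fintype A] [Fintype V] [DecidableEq V] in
/-- The points of a face that reaches all vertices from `i` are minimal in their fibre. -/
theorem ReachesAll.potential_le {I : PESP V A} {L U : Set A} {i : V}
    (h : I.ReachesAll (barArcs L U) i) {x y : A → ℝ} (hx : x ∈ I.cubeFace L U) (hy : y ∈ I.cube)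
    {c : V → ℝ} (hc : ∀ a, y a - x a = c (I.src a) - c (I.tgt a)) (v : V) : c i ≤ c v := by
  refine h.le (fun e he => ?_) v
  rcases e with a | a
  · have h1 := hx.2.2 a (inl_mem_barArcs.1 he)
    have h2 := (hy a).2
    have h3 := hc a
    simp only [barSrc, barTgt, Sum.elim_inl]
    linarith
  · have h1 := hx.2.1 a (inr_mem_barArcs.1 he)
    have h2 := (hy a).1
    have h3 := hc a
    simp only [barSrc, barTgt, Sum.elim_inr]
    linarith

/-- The potential of the difference is both minimal and maximal at `i`, hence constant. -/
theorem IsIntegralCycleBasis.eq_of_offsetMap_eq {I : PESP V A} {Γ : Matrix ι A ℤ}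
    (hΓ : I.IsIntegralCycleBasis Γ) {i : V} {L U L' U' : Set A}
    (h : I.ReachesAll (barArcs L U) i) (h' : I.ReachesAll (barArcs L' U') i) {x y : A → ℝ}
    (hx : x ∈ I.cubeFace L U) (hy : y ∈ I.cubeFace L' U')
    (hxy : I.offsetMap Γ x = I.offsetMap Γ y) : x = y := by
  obtain ⟨c, hc⟩ := hΓ.offsetMap_eq_offsetMap.1 hxy
  have h1 := h'.potential_le hy hx.1 hc
  have h2 := h.potential_le hx hy.1 (c := fun v => -c v) fun a => by linarith [hc a]
  ext a
  have := hc a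
  linarith [h1 (I.src a), h2 (I.src a), h1 (I.tgt a), h2 (I.tgt a)]

/-- Every fibre of the offset map over the zonotope contains a point of a bounded face. -/
theorem IsIntegralCycleBasis.exists_mem_cubeFace {I : PESP V A}
    (hfree : ∀ a, I.l a < I.u a) {Γ : Matrix ι A ℤ} (hΓ : I.IsIntegralCycleBasis Γ) (i : V)
    {x₀ : A → ℝ} (hx₀ : x₀ ∈ I.cube) :
    ∃ L U : Set A, L ∩ U = ∅ ∧ I.ReachesAll (barArcs L U) i ∧
      ∃ x ∈ I.cubeFace L U, I.offsetMap Γ x = I.offsetMap Γ x₀ := by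
  obtain ⟨g, -, -, hf⟩ := (I.reachesAll_univ i).exists_positive_flow
  set f : A → ℝ := fun a => g (Sum.inl a) - g (Sum.inr a)
  have hcont : Continuous (I.offsetMap Γ) :=
    (I.offsetLinear Γ).continuous_of_finiteDimensional
  have hK : IsCompact (I.cube ∩ I.offsetMap Γ ⁻¹' {I.offsetMap Γ x₀}) :=
    I.isCompact_cube.inter_right (isClosed_singleton.preimage hcont)
  obtain ⟨x, ⟨hx, hxx₀⟩, hmax⟩ := hK.exists_isMaxOn ⟨x₀, hx₀, rfl⟩
    (f := fun x => ∑ a, f a * x a) (by fun_prop)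
  -- All tight coordinates of the maximizer are taken into `L` and `U`.
  have hxF : x ∈ I.cubeFace {a | x a = I.l a} {a | x a = I.u a} :=
    ⟨hx, fun a ha => ha, fun a ha => ha⟩
  refine ⟨_, _, inter_eq_empty_of_nonempty_cubeFace hfree ⟨x, hxF⟩, ?_, x, hxF, hxx₀⟩
  refine reachesAll_of_forall fun W hi hW => ?_
  by_contra hne
  have hneg := sum_divergence_neg hf hi (Set.nonempty_iff_ne_empty.2 hne)
  let d : A → ℝ := fun a => W.indicator 1 (I.src a) - W.indicator 1 (I.tgt a)
  rw [sum_divergence_indicator] at hneg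
  -- If `W` cannot be entered, an arc leaving `W` is not tight below and an arc entering `W` is not
  -- tight above. So `x` can move slightly along `-d` within the fibre, and this increases the
  -- objective.
  have hev : ∀ᶠ ε : ℝ in nhdsWithin 0 (Set.Ioi 0), ∀ a, I.l a ≤ x a - ε * d a ∧
      x a - ε * d a ≤ I.u a := by
    rw [Filter.eventually_all]
    intro a
    have hxa := hx a
    by_cases hs : I.src a ∈ W <;> by_cases ht : I.tgt a ∈ W
    · simp [d, hs, ht, hxa.1, hxa.2]
    · have hl : I.l a < x a := lt_of_le_of_ne hxa.1 fun h =>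
        hW (Sum.inr a) (inr_mem_barArcs.2 h.symm) ht hs
      filter_upwards [Ioo_mem_nhdsGT (sub_pos.2 hl)] with ε hε
      simp only [d, hs, ht, Set.indicator_of_mem, Set.indicator_of_notMem, not_false_eq_true,
        Pi.one_apply]
      constructor <;> linarith [hε.1, hε.2]
    · have hu : x a < I.u a := lt_of_le_of_ne hxa.2 fun h =>
        hW (Sum.inl a) (inl_mem_barArcs.2 h) hs ht
      filter_upwards [Ioo_mem_nhdsGT (sub_pos.2 hu)] with ε hε
      simp only [d, hs, ht, Set.indicator_of_mem, Set.indicator_of_notMem, not_false_eq_true,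
        Pi.one_apply]
      constructor <;> linarith [hε.1, hε.2]
    · simp [d, hs, ht, hxa.1, hxa.2]
  obtain ⟨ε, hε, hε0⟩ := (hev.and self_mem_nhdsWithin).exists
  have hε0 : 0 < ε := hε0
  have hmem : (fun a => x a - ε * d a) ∈ I.cube ∩ I.offsetMap Γ ⁻¹' {I.offsetMap Γ x₀} := by
    refine ⟨hε, ?_⟩
    rw [Set.mem_preimage, Set.mem_singleton_iff, ← show I.offsetMap Γ x = I.offsetMap Γ x₀ from hxx₀,
      hΓ.offsetMap_eq_offsetMap]
    refine ⟨fun v => -ε * W.indicator 1 v, fun a => ?_⟩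
    simp only [d]
    ring
  have h1 := hmax hmem
  simp only [Set.mem_ofPred_eq, mul_sub (f _), Finset.sum_sub_distrib] at h1
  have h2 : ∑ a, f a * (ε * d a) = ε * ∑ a, f a * d a := by
    rw [Finset.mul_sum]
    exact Finset.sum_congr rfl fun a _ => by ring
  rw [h2] at h1
  have h3 : ε * ∑ a, f a * d a < 0 := mul_neg_of_pos_of_neg hε0 hneg
  linarith

omit [Fintype V] [DecidableEq V] [Fintype ι] in
/-- Faces of the image of a cube face are images of cube faces. -/
theorem setOf_forall_le_offsetMap_image [DecidableEq A] (I : PESP V A) (Γ : Matrix ι A ℤ)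
    {L U : Set A} (hLU : L ∩ U = ∅) (ψ : (ι → ℝ) →ₗ[ℝ] ℝ) (f : A → ℝ)
    (hf : ∀ x, ψ (I.offsetMap Γ x) = ∑ a, f a * x a) :
    {y ∈ I.offsetMap Γ '' I.cubeFace L U | ∀ y' ∈ I.offsetMap Γ '' I.cubeFace L U, ψ y' ≤ ψ y} =
      I.offsetMap Γ '' I.cubeFace (L ∪ {a | a ∉ U ∧ f a < 0}) (U ∪ {a | a ∉ L ∧ 0 < f a}) := by
  rw [← I.setOf_forall_le_cubeFace hLU]
  ext y
  constructor
  · rintro ⟨⟨x, hx, rfl⟩, hmax⟩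
    refine ⟨x, ⟨hx, fun y hy => ?_⟩, rfl⟩
    rw [← hf, ← hf]
    exact hmax _ ⟨y, hy, rfl⟩
  · rintro ⟨x, ⟨hx, hmax⟩, rfl⟩
    refine ⟨⟨x, hx, rfl⟩, ?_⟩
    rintro _ ⟨y, hy, rfl⟩
    rw [hf, hf]
    exact hmax y hy

theorem IsIntegralCycleBasis.isFaceOf_offsetMap_image {I : PESP V A} {Γ : Matrix ι A ℤ}
    (hΓ : I.IsIntegralCycleBasis Γ) {i : V} {L U L' U' : Set A}
    (h : I.ReachesAll (barArcs L U) i) (hL : L ⊆ L') (hU : U ⊆ U') (hLU : L' ∩ U' = ∅) :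
    IsFaceOf (I.offsetMap Γ '' I.cubeFace L U) (I.offsetMap Γ '' I.cubeFace L' U') := by
  classical
  refine ⟨(I.cubeFace_nonempty hLU).image _, fun _ => ?_⟩
  have hdis : ∀ a ∈ L', a ∉ U' := fun a ha h => by
    simpa [hLU] using (show a ∈ L' ∩ U' from ⟨ha, h⟩)
  have hLU₀ : L ∩ U = ∅ := Set.eq_empty_iff_forall_notMem.2 fun a ha =>
    hdis a (hL ha.1) (hU ha.2)
  -- The functional `s` selects `L'` and `U'` but need not factor through `Γ`. Subtracting `r`,
  -- which has the same divergence and lives on `L ∪ U`, yields a circulation; as those coordinates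
  -- are fixed on the larger face, the maximizers do not change.
  let s : A → ℝ := fun a => if a ∈ L' then -1 else if a ∈ U' then 1 else 0
  obtain ⟨r, hr0, hr⟩ := h.exists_divergence_eq (I.incidence ℝ *ᵥ s) (by
    have := I.sum_incidence_mulVec_mul s (fun _ => 1)
    simpa using this)
  obtain ⟨g, hg⟩ := hΓ.exists_functional (h := s - r) (by rw [Matrix.mulVec_sub, hr, sub_self])
  refine ⟨LinearMap.toContinuousLinearMap ((I.T : ℝ) • g), ?_⟩
  have := I.setOf_forall_le_offsetMap_image Γ hLU₀ ((I.T : ℝ) • g) (s - r) fun x => by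
    rw [LinearMap.smul_apply, ← map_smul, ← (I.offsetMap_eq_iff Γ x _).1 rfl, hg]
  refine Eq.trans ?_ this.symm
  congr 2
  · ext a
    by_cases h1 : a ∈ L
    · simp [h1, hL h1]
    by_cases h2 : a ∈ U
    · have : a ∉ L' := fun h => hdis a h (hU h2)
      simp [h1, h2, this]
    · simp only [Set.mem_union, h1, h2, false_or, Set.mem_ofPred_eq, not_false_eq_true, true_and,
        Pi.sub_apply, hr0 a h1 h2, sub_zero, s]
      split_ifs <;> simp_all
  · ext a
    by_cases h2 : a ∈ U
    · simp [h2, hU h2]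
    by_cases h1 : a ∈ L
    · simp [h1, h2, hdis a (hL h1)]
    · simp only [Set.mem_union, h1, h2, false_or, Set.mem_ofPred_eq, not_false_eq_true, true_and,
        Pi.sub_apply, hr0 a h1 h2, sub_zero, s]
      split_ifs with h3 h4
      · simp [hdis a h3]
      · simp [h4]
      · simp [h4]

omit [Fintype V] [DecidableEq V] [Fintype ι] in
theorem exists_cubeFace_of_isFaceOf (I : PESP V A) (Γ : Matrix ι A ℤ)
    (hfree : ∀ a, I.l a < I.u a) {L U : Set A} (hLU : L ∩ U = ∅) {F : Set (ι → ℝ)}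
    (hF : IsFaceOf (I.offsetMap Γ '' I.cubeFace L U) F) :
    ∃ L' U' : Set A, L ⊆ L' ∧ U ⊆ U' ∧ L' ∩ U' = ∅ ∧
      F = I.offsetMap Γ '' I.cubeFace L' U' := by
  classical
  obtain ⟨hne, hexp⟩ := hF
  obtain ⟨ψ, rfl⟩ := hexp hne
  have h := I.setOf_forall_le_offsetMap_image Γ hLU ψ.toLinearMap
    (fun a => ψ (I.offsetMap Γ (Pi.single a 1))) fun x =>
      map_eq_sum_mul (ψ.toLinearMap ∘ₗ I.offsetLinear Γ) x
  change {y ∈ I.offsetMap Γ '' I.cubeFace L U |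
    ∀ y' ∈ I.offsetMap Γ '' I.cubeFace L U, ψ y' ≤ ψ y} = _ at h
  rw [h] at hne ⊢
  exact ⟨_, _, Set.subset_union_left, Set.subset_union_left,
    inter_eq_empty_of_nonempty_cubeFace hfree (Set.image_nonempty.1 hne), rfl⟩

theorem IsIntegralCycleBasis.isPolyhedralSubdivision_inducedCells {I : PESP V A}
    (hfree : ∀ a, I.l a < I.u a) {Γ : Matrix ι A ℤ} (hΓ : I.IsIntegralCycleBasis Γ) (i : V) :
    IsPolyhedralSubdivision (I.offsetZonotope Γ) (I.inducedCells Γ i) where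
  finite := by
    refine (Set.finite_range fun p : Set A × Set A =>
      I.offsetMap Γ '' I.cubeFace p.1 p.2).subset fun C hC => ?_
    obtain ⟨L, U, -, -, rfl⟩ := mem_inducedCells_iff.1 hC
    exact ⟨(L, U), rfl⟩
  nonempty := by
    intro C hC
    obtain ⟨L, U, h, -, rfl⟩ := mem_inducedCells_iff.1 hC
    exact (I.cubeFace_nonempty h).image _
  polytope := by
    classical
    intro C hC
    obtain ⟨L, U, h, -, rfl⟩ := mem_inducedCells_iff.1 hC
    obtain ⟨s, hs⟩ := I.isPolytope_cubeFace h
    refine ⟨s.image (I.offsetMap Γ), ?_⟩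
    rw [hs, ← coe_offsetLinear, LinearMap.image_convexHull, Finset.coe_image]
  cover := by
    rw [← offsetMap_image_cube]
    ext z
    constructor
    · rintro ⟨C, hC, hz⟩
      obtain ⟨L, U, -, -, rfl⟩ := mem_inducedCells_iff.1 hC
      exact Set.image_mono (I.cubeFace_subset_cube L U) hz
    · rintro ⟨x₀, hx₀, rfl⟩
      obtain ⟨L, U, h, hr, x, hx, hxx⟩ := hΓ.exists_mem_cubeFace hfree i hx₀
      exact ⟨_, mem_inducedCells_iff.2 ⟨L, U, h, hr, rfl⟩, x, hx, hxx⟩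
  face_mem := by
    intro C hC F hF
    obtain ⟨L, U, h, hr, rfl⟩ := mem_inducedCells_iff.1 hC
    obtain ⟨L', U', hL, hU, h', rfl⟩ := I.exists_cubeFace_of_isFaceOf Γ hfree h hF
    exact mem_inducedCells_iff.2 ⟨L', U', h', hr.mono (barArcs_mono hL hU), rfl⟩
  inter := by
    have key : ∀ C ∈ I.inducedCells Γ i, ∀ D ∈ I.inducedCells Γ i, (C ∩ D).Nonempty →
        IsFaceOf C (C ∩ D) := by
      intro C hC D hD hne
      obtain ⟨L, U, h, hr, rfl⟩ := mem_inducedCells_iff.1 hC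
      obtain ⟨L', U', h', hr', rfl⟩ := mem_inducedCells_iff.1 hD
      have heq : I.offsetMap Γ '' I.cubeFace L U ∩ I.offsetMap Γ '' I.cubeFace L' U' =
          I.offsetMap Γ '' I.cubeFace (L ∪ L') (U ∪ U') := by
        rw [← cubeFace_inter]
        refine subset_antisymm ?_ (Set.image_inter_subset _ _ _)
        rintro _ ⟨⟨x, hx, rfl⟩, y, hy, hyx⟩
        obtain rfl := hΓ.eq_of_offsetMap_eq hr' hr hy hx hyx
        exact ⟨y, ⟨hx, hy⟩, rfl⟩
      rw [heq] at hne ⊢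
      exact hΓ.isFaceOf_offsetMap_image hr Set.subset_union_left Set.subset_union_left
        (inter_eq_empty_of_nonempty_cubeFace hfree (Set.image_nonempty.1 hne))
    exact fun C hC D hD hne => ⟨key C hC D hD hne,
      Set.inter_comm C D ▸ key D hD C hC (Set.inter_comm C D ▸ hne)⟩

omit [Fintype V] [DecidableEq V] [Fintype ι] in
theorem offsetMap_image_cubeFace_eq_vadd (I : PESP V A) (hfree : ∀ a, I.l a < I.u a)
    (Γ : Matrix ι A ℤ) {L U : Set A} (hLU : L ∩ U = ∅) :
    ∃ b : ι → ℝ, I.offsetMap Γ '' I.cubeFace L U =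
      b +ᵥ zonotopeDel (I.scaledCycleMatrix Γ) (L ∪ U) := by
  classical
  -- The vertex of the face with all free coordinates at their lower bounds; it becomes the
  -- translation vector.
  let o : A → ℝ := fun a => if a ∈ U then I.u a else I.l a
  have hdis : ∀ a ∈ L, a ∉ U := fun a ha h => by
    simpa [hLU] using (show a ∈ L ∩ U from ⟨ha, h⟩)
  have hoff : ∀ y : A → ℝ, I.offsetMap Γ (fun a => o a + (I.u a - I.l a) * y a) =
      I.offsetMap Γ o + I.scaledCycleMatrix Γ *ᵥ y := by
    intro y
    have h1 : (fun a => o a + (I.u a - I.l a) * y a) = o + fun a => (I.u a - I.l a) * y a := rfl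
    rw [h1, ← coe_offsetLinear, map_add]
    congr 1
    ext k
    simp only [coe_offsetLinear, offsetMap, Pi.smul_apply, Matrix.mulVec, dotProduct, smul_eq_mul,
      Finset.mul_sum, Matrix.map_apply, scaledCycleMatrix, Matrix.of_apply]
    exact Finset.sum_congr rfl fun a _ => by ring
  refine ⟨I.offsetMap Γ o, ?_⟩
  ext z
  rw [Set.mem_vadd_set]
  constructor
  · rintro ⟨x, hx, rfl⟩
    have hy : x = fun a => o a + (I.u a - I.l a) * ((x a - o a) / (I.u a - I.l a)) := by
      ext a
      rw [mul_div_cancel₀ _ (sub_pos.2 (hfree a)).ne']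
      ring
    refine ⟨_, ⟨fun a => (x a - o a) / (I.u a - I.l a), fun a => ?_, fun a ha => ?_, rfl⟩, ?_⟩
    · have hpos := sub_pos.2 (hfree a)
      have hxa := hx.1 a
      rw [div_le_one hpos]
      by_cases haU : a ∈ U
      · simp [o, haU, hx.2.2 a haU, hpos.le]
      · simp only [o, haU, if_false]
        exact ⟨div_nonneg (by linarith) hpos.le, by linarith⟩
    · rcases ha with ha | ha
      · simp [o, hdis a ha, hx.2.1 a ha]
      · simp [o, ha, hx.2.2 a ha]
    · conv_rhs => rw [hy, hoff]
      rfl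
  · rintro ⟨_, ⟨y, hy1, hy2, rfl⟩, rfl⟩
    refine ⟨_, ⟨fun a => ?_, fun a ha => ?_, fun a ha => ?_⟩, hoff y⟩
    · have hpos := sub_pos.2 (hfree a)
      by_cases haU : a ∈ U
      · simp [o, haU, hy2 a (Or.inr haU), (hfree a).le]
      · simp only [o, haU, if_false]
        constructor <;> nlinarith [hy1 a]
    · simp [o, hdis a ha, hy2 a (Or.inl ha)]
    · simp [o, ha, hy2 a (Or.inr ha)]

/-- A linear relation is a potential difference that vanishes on `S`; connectedness of `S` makes the
potential constant, so the relation is trivial. -/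
theorem IsIntegralCycleBasis.linearIndependent_columns {I : PESP V A}
    (hfree : ∀ a, I.l a < I.u a) {Γ : Matrix ι A ℤ} (hΓ : I.IsIntegralCycleBasis Γ) {S : Set A}
    (hS : (arcGraph I.src I.tgt S).Connected) :
    LinearIndependent ℝ (fun a : (Sᶜ : Set A) => fun k => I.scaledCycleMatrix Γ k a) := by
  classical
  rw [Fintype.linearIndependent_iff]
  intro g hg
  let x : A → ℝ := fun a => if h : a ∈ Sᶜ then g ⟨a, h⟩ * ((I.u a - I.l a) / I.T) else 0
  have hx : Γ.map (Int.cast : ℤ → ℝ) *ᵥ x = 0 := by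
    ext k
    have h1 := congrFun hg k
    rw [Finset.sum_apply] at h1
    rw [Pi.zero_apply, ← show _ = (0 : ℝ) from h1]
    simp only [Matrix.mulVec, dotProduct, Matrix.map_apply, Pi.smul_apply, smul_eq_mul,
      scaledCycleMatrix, Matrix.of_apply]
    rw [← Finset.sum_subset (Finset.subset_univ (Finset.univ.filter (· ∈ Sᶜ)))]
    · rw [Finset.sum_subtype (p := (· ∈ Sᶜ)) _ (by simp)]
      refine Finset.sum_congr rfl fun a _ => ?_
      have ha : (a : A) ∈ Sᶜ := a.2
      simp only [x, ha, dif_pos]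
      ring
    · intro a _ ha
      have ha' : a ∉ Sᶜ := by simpa using ha
      simp only [x, ha', dif_neg, not_false_eq_true, mul_zero]
  obtain ⟨c, hc⟩ := hΓ.exists_potential hx
  rw [incidence_transpose_mulVec] at hc
  have hconst : ∀ v w, c v = c w := fun v w =>
    eq_of_arcGraph_reachable (S := S) (src := I.src) (tgt := I.tgt) (fun a ha => by
      have := congrFun hc a
      have ha' : a ∉ Sᶜ := fun h => h ha
      simp only [x, ha', dif_neg, not_false_eq_true] at this
      linarith) (hS v w)
  rintro ⟨a, ha⟩
  have h1 := congrFun hc a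
  simp only [x, ha, dif_pos, hconst (I.src a) (I.tgt a), sub_self] at h1
  have h2 : (I.u a - I.l a) / I.T ≠ 0 :=
    div_ne_zero (sub_pos.2 (hfree a)).ne' I.T_ne_zero
  exact (mul_eq_zero.1 h1).resolve_right h2

theorem IsIntegralCycleBasis.isFineZonotopalTiling_inducedCells {I : PESP V A}
    (hfree : ∀ a, I.l a < I.u a) {Γ : Matrix ι A ℤ} (hΓ : I.IsIntegralCycleBasis Γ) (i : V) :
    IsFineZonotopalTiling (I.scaledCycleMatrix Γ) (I.offsetZonotope Γ) (I.inducedCells Γ i) := by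
  have key : ∀ C ∈ I.inducedCells Γ i, ∃ (S : Set A) (b : ι → ℝ),
      C = b +ᵥ zonotopeDel (I.scaledCycleMatrix Γ) S ∧
      LinearIndependent ℝ (fun a : (Sᶜ : Set A) => fun k => I.scaledCycleMatrix Γ k a) := by
    intro C hC
    obtain ⟨L, U, h, hr, rfl⟩ := mem_inducedCells_iff.1 hC
    obtain ⟨b, hb⟩ := I.offsetMap_image_cubeFace_eq_vadd hfree Γ h
    exact ⟨L ∪ U, b, hb, hΓ.linearIndependent_columns hfree hr.connected⟩
  refine ⟨⟨hΓ.isPolyhedralSubdivision_inducedCells hfree i, fun C hC => ?_⟩,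
    fun C hC => key C hC.prop⟩
  obtain ⟨S, b, h, -⟩ := key C hC
  exact ⟨S, b, h⟩

end Offset

end PESP

/-! ### Tropical convex hulls and vertices -/

section TropicalConvexity

variable {V : Type*}

theorem subset_tropicalHull (M : Set (V → ℝ)) : M ⊆ tropicalHull M :=
  Set.subset_sInter fun _ hS => hS.2

theorem tropicalHull_subset {M S : Set (V → ℝ)} (hS : IsTropicallyConvex S) (h : M ⊆ S) :
    tropicalHull M ⊆ S := Set.sInter_subset_of_mem ⟨hS, h⟩

theorem isTropicallyConvex_tropicalHull (M : Set (V → ℝ)) : IsTropicallyConvex (tropicalHull M) :=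
  fun x hx y hy a b S hS => hS.1 x (hx S hS) y (hy S hS) a b

theorem IsTropicallyConvex.add_const_mem {S : Set (V → ℝ)} (hS : IsTropicallyConvex S)
    {x : V → ℝ} (hx : x ∈ S) (a : ℝ) : (fun v => a + x v) ∈ S := by
  simpa using hS x hx x hx a a

theorem IsTropicallyConvex.inf'_mem {S : Set (V → ℝ)} (hS : IsTropicallyConvex S) {ι : Type*}
    {s : Finset ι} (hs : s.Nonempty) {y : ι → V → ℝ} (hy : ∀ j ∈ s, y j ∈ S) :
    (fun v => s.inf' hs fun j => y j v) ∈ S := by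
  induction hs using Finset.Nonempty.cons_induction with
  | singleton j => simpa using hy j (by simp)
  | cons j s hj hs ih =>
    have h1 := ih fun k hk => hy k (Finset.mem_cons_of_mem hk)
    have h2 := hS _ (hy j (Finset.mem_cons_self j s)) _ h1 0 0
    simpa [Finset.inf'_cons hs] using h2

/-- In a tropically convex set that has for each coordinate `j` a point `ρ j` that is maximal
relative to that coordinate, such points are tropical vertices. -/
theorem isTropicalVertex_of_forall_le [Finite V] {R : Set (V → ℝ)} (hR : IsTropicallyConvex R)
    {ρ : V → V → ℝ} (hρ : ∀ j, ρ j ∈ R) (hmax : ∀ j, ∀ x ∈ R, ∀ v, x v - x j ≤ ρ j v - ρ j j)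
    {i : V} {π : V → ℝ} (hπ : π ∈ R) (hπmax : ∀ x ∈ R, ∀ v, x v - x i ≤ π v - π i) :
    IsTropicalVertex R π := by
  have := Fintype.ofFinite V
  -- Removing the class of `π` leaves a tropically convex set: if a tropical combination equals a
  -- translate of `π`, the term attaining the minimum at `i` lies above that translate and agrees
  -- with it at `i`, so by maximality it is itself a translate of `π`.
  let R' : Set (V → ℝ) := {x | x ∈ R ∧ ¬ ∃ c : ℝ, x = fun v => c + π v}
  have hR' : IsTropicallyConvex R' := by
    have key : ∀ x ∈ R, ∀ y : V → ℝ, ∀ a b c : ℝ, a + x i ≤ b + y i →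
        (fun v => min (a + x v) (b + y v)) = (fun v => c + π v) →
        ∃ c' : ℝ, x = fun v => c' + π v := by
      intro x hx y a b c hle heq
      refine ⟨c - a, funext fun v => ?_⟩
      have h1 := congrFun heq i
      have h2 := congrFun heq v
      simp only [min_eq_left hle] at h1
      have h3 : c + π v ≤ a + x v := h2 ▸ min_le_left _ _
      have h4 := hπmax x hx v
      linarith
    rintro x ⟨hx, hx'⟩ y ⟨hy, hy'⟩ a b
    refine ⟨hR x hx y hy a b, ?_⟩
    rintro ⟨c, hc⟩
    rcases le_total (a + x i) (b + y i) with h | h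
    · exact hx' (key x hx y a b c h hc)
    · refine hy' (key y hy x b a c h ?_)
      rw [← hc]
      exact funext fun v => min_comm _ _
  -- A finite generating set in which `π` is the only member of its class. A minimal generating
  -- subset must keep `π`, as otherwise it would generate only a subset of `R'`.
  let M₀ : Set (V → ℝ) := insert π (Set.range ρ ∩ R')
  have hM₀fin : M₀.Finite := ((Set.finite_range ρ).inter_of_left R').insert π
  have hM₀R : M₀ ⊆ R := by
    rintro x (rfl | ⟨-, hx⟩)
    · exact hπ
    · exact hx.1
  have hM₀ : tropicalHull M₀ = R := by
    refine subset_antisymm (tropicalHull_subset hR hM₀R) fun x hx => ?_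
    have hc := isTropicallyConvex_tropicalHull M₀
    have hρM : ∀ j, ρ j ∈ tropicalHull M₀ := by
      intro j
      by_cases h : ∃ c : ℝ, ρ j = fun v => c + π v
      · obtain ⟨c, h⟩ := h
        rw [h]
        exact hc.add_const_mem (subset_tropicalHull _ (Set.mem_insert _ _)) c
      · exact subset_tropicalHull _ (Set.mem_insert_of_mem _ ⟨⟨j, rfl⟩, hρ j, h⟩)
    have hne : (Finset.univ : Finset V).Nonempty := ⟨i, Finset.mem_univ i⟩
    -- Each `x` is the minimum of the translates of `ρ j` that agree with `x` at `j`: all lie above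
    -- `x` by maximality.
    have h := hc.inf'_mem hne (y := fun j v => (x j - ρ j j) + ρ j v)
      fun j _ => hc.add_const_mem (hρM j) _
    convert h using 1
    ext v
    refine le_antisymm (Finset.le_inf' _ _ fun j _ => ?_)
      ((Finset.inf'_le _ (Finset.mem_univ v)).trans (by simp))
    linarith [hmax j x hx v]
  obtain ⟨M, hM⟩ := Set.Finite.exists_minimal (s := {N | N ⊆ M₀ ∧ tropicalHull N = R})
    (hM₀fin.finite_subsets.subset fun N hN => hN.1) ⟨M₀, subset_rfl, hM₀⟩
  refine ⟨M, ⟨hM.prop.2, fun N hN hNM => hM.le_of_le ⟨hNM.trans hM.prop.1, hN⟩ hNM⟩, ?_⟩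
  by_contra hπM
  have hMR' : M ⊆ R' := fun x hx => by
    rcases hM.prop.1 hx with rfl | h
    · exact absurd hx hπM
    · exact h.2
  have := tropicalHull_subset hR' hMR'
  rw [hM.prop.2] at this
  exact (this hπ).2 ⟨0, by simp⟩

end TropicalConvexity

namespace PESP

/-! ### Arborescences inside reachable subgraphs -/

section Arborescences

variable {V A : Type*}

theorem ReachesAll.exists_parent {I : PESP V A} {K : Set (A ⊕ A)} {i : V}
    (h : I.ReachesAll K i) :
    ∃ d : V → ℕ, ∀ v ≠ i, ∃ e ∈ K, I.barTgt e = v ∧ d (I.barSrc e) < d v := by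
  classical
  -- `R n` consists of the ends of walks with exactly `n` arcs from `i`; the depth `d` is the least
  -- such `n`, and the last arc of a shortest walk lowers it.
  obtain ⟨R, hR0, hRs⟩ : ∃ R : ℕ → Set V, R 0 = {i} ∧
      ∀ n, R (n + 1) = {v | ∃ e ∈ K, I.barTgt e = v ∧ I.barSrc e ∈ R n} :=
    ⟨fun n => Nat.rec {i} (fun _ S => {v | ∃ e ∈ K, I.barTgt e = v ∧ I.barSrc e ∈ S}) n,
      rfl, fun _ => rfl⟩
  have hR : ∀ v, ∃ n : ℕ, v ∈ R n := by
    intro v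
    induction h v with
    | refl => exact ⟨0, by simp [hR0]⟩
    | tail _ hbc ih =>
      obtain ⟨e, he, rfl, rfl⟩ := hbc
      obtain ⟨n, hn⟩ := ih
      exact ⟨n + 1, by rw [hRs]; exact ⟨e, he, rfl, hn⟩⟩
  refine ⟨fun v : V => Nat.find (hR v), fun v hv => ?_⟩
  have hmem := Nat.find_spec (hR v)
  rcases hn : Nat.find (hR v) with - | n
  · rw [hn, hR0] at hmem
    exact absurd hmem hv
  · rw [hn, hRs] at hmem
    obtain ⟨e, he, h1, h2⟩ := hmem
    refine ⟨e, he, h1, ?_⟩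
    dsimp only
    rw [hn]
    exact Nat.lt_succ_of_le (Nat.find_min' (hR (I.barSrc e)) h2)

/-- If all vertices can be reached from `i` along arcs of `L` and `U`, then some of these arcs form
an arborescence, whose underlying graph is a spanning tree. -/
theorem ReachesAll.exists_arborescence [Finite V] {I : PESP V A} {L U : Set A} {i : V}
    (h : I.ReachesAll (barArcs L U) i) (hLU : L ∩ U = ∅) :
    ∃ L' ⊆ L, ∃ U' ⊆ U, I.IsArborescence (barArcs L' U') i ∧
      I.IsSpanningTreeStructure (L' ∪ U') L' U' := by
  classical
  have := Fintype.ofFinite V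
  obtain ⟨d, hd⟩ := h.exists_parent
  choose e heK het hed using hd
  let K : Set (A ⊕ A) := {x | ∃ v, ∃ hv : v ≠ i, e v hv = x}
  have hKeq : barArcs {a | Sum.inr a ∈ K} {a | Sum.inl a ∈ K} = K := by
    ext (a | a) <;> simp
  have hreach : I.ReachesAll K i := by
    intro v
    induction hn : d v using Nat.strong_induction_on generalizing v with
    | _ n ih =>
      by_cases hv : v = i
      · rw [hv]
      · exact (ih _ (hn ▸ hed v hv) _ rfl).tail ⟨e v hv, ⟨v, hv, rfl⟩, rfl, het v hv⟩
  refine ⟨{a | Sum.inr a ∈ K}, ?_, {a | Sum.inl a ∈ K}, ?_, ?_, rfl, ?_, ?_⟩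
  · rintro a ⟨v, hv, ha⟩
    exact inr_mem_barArcs.1 (ha ▸ heK v hv)
  · rintro a ⟨v, hv, ha⟩
    exact inl_mem_barArcs.1 (ha ▸ heK v hv)
  · rw [hKeq]
    refine ⟨hreach, ?_, fun v hv => ⟨e v hv, ⟨⟨v, hv, rfl⟩, het v hv⟩, ?_⟩⟩
    · rintro _ ⟨v, hv, rfl⟩
      rwa [het v hv]
    · rintro _ ⟨⟨w, hw, rfl⟩, hwv⟩
      rw [het w hw] at hwv
      subst hwv
      rfl
  · refine Set.eq_empty_iff_forall_notMem.2 ?_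
    rintro a ⟨⟨v, hv, ha⟩, w, hw, ha'⟩
    have h1 : a ∈ L := inr_mem_barArcs.1 (ha ▸ heK v hv)
    have h2 : a ∈ U := inl_mem_barArcs.1 (ha' ▸ heK w hw)
    simpa [hLU] using (show a ∈ L ∩ U from ⟨h1, h2⟩)
  · have hconn := ReachesAll.connected (hKeq.symm ▸ hreach)
    -- Each edge comes from the parent arc of a vertex other than `i`, so there are at most $|V|-1$
    -- edges; connectedness gives the reverse bound.
    rw [SimpleGraph.isTree_iff_connected_and_card]
    refine ⟨hconn, le_antisymm ?_ hconn.card_vert_le_card_edgeSet_add_one⟩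
    let t : Finset {v // v ≠ i} := Finset.univ
    let f : {v // v ≠ i} → Sym2 V := fun v => s(I.barSrc (e v v.2), I.barTgt (e v v.2))
    have hsub : (arcGraph I.src I.tgt ({a | Sum.inr a ∈ K} ∪ {a | Sum.inl a ∈ K})).edgeSet ⊆
        Set.range f := by
      intro x
      induction x using Sym2.ind with
      | _ v w =>
      intro hx
      rw [SimpleGraph.mem_edgeSet, arcGraph_adj_iff] at hx
      obtain ⟨-, a, ha, hor⟩ := hx
      have hedge : s(I.src a, I.tgt a) = s(v, w) := by
        rcases hor with ⟨rfl, rfl⟩ | ⟨rfl, rfl⟩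
        · rfl
        · exact Sym2.eq_swap
      rw [← hedge]
      rcases ha with ⟨y, hy, hya⟩ | ⟨y, hy, hya⟩
      · exact ⟨⟨y, hy⟩, by simp only [f, hya]; exact Sym2.eq_swap⟩
      · exact ⟨⟨y, hy⟩, by simp only [f, hya]; rfl⟩
    have h1 := Nat.card_mono (Set.finite_range f) hsub
    have h2 := Finite.card_range_le f
    have h3 : Nat.card {v // v ≠ i} + 1 = Nat.card V := by
      have : 0 < Fintype.card V := Fintype.card_pos_iff.2 ⟨i⟩
      rw [Nat.card_eq_fintype_card, Nat.card_eq_fintype_card, Fintype.card_subtype_compl,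
        Fintype.card_subtype_eq]
      omega
    omega

end Arborescences

/-! ### Potentials and walk lengths -/

section Walks

variable {V A : Type*}

theorem IsWalk.sub_le {I : PESP V A} {κ : A ⊕ A → ℝ} {K : Set (A ⊕ A)} {π : V → ℝ}
    (hπ : ∀ e ∈ K, π (I.barTgt e) - π (I.barSrc e) ≤ κ e) {v w : V} {c : ℝ}
    (h : I.IsWalk κ K v w c) : π w - π v ≤ c := by
  induction h with
  | nil => simp
  | snoc e he _ ih => linarith [hπ e he]

theorem IsWalk.eq_sub {I : PESP V A} {κ : A ⊕ A → ℝ} {K : Set (A ⊕ A)} {π : V → ℝ}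
    (hπ : ∀ e ∈ K, π (I.barTgt e) - π (I.barSrc e) = κ e) {v w : V} {c : ℝ}
    (h : I.IsWalk κ K v w c) : c = π w - π v := by
  induction h with
  | nil => simp
  | snoc e he _ ih => linarith [hπ e he]

theorem ReachesAll.isWalk {I : PESP V A} {κ : A ⊕ A → ℝ} {K : Set (A ⊕ A)} {i : V} {π : V → ℝ}
    (h : I.ReachesAll K i) (hπ : ∀ e ∈ K, π (I.barTgt e) - π (I.barSrc e) = κ e) (v : V) :
    I.IsWalk κ Set.univ i v (π v - π i) := by
  induction h v with
  | refl => simpa using IsWalk.nil (I := I) (κ := κ) (K := Set.univ) i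
  | tail _ hbc ih =>
    obtain ⟨e, he, rfl, rfl⟩ := hbc
    have := IsWalk.snoc e (Set.mem_univ e) ih
    rwa [← hπ e he, show π (I.barSrc e) - π i + (π (I.barTgt e) - π (I.barSrc e)) =
      π (I.barTgt e) - π i by ring] at this

theorem sub_le_kappa {I : PESP V A} {p : A → ℤ} {π : V → ℝ} (h : π ∈ I.timetablePolyhedron p)
    (e : A ⊕ A) : π (I.barTgt e) - π (I.barSrc e) ≤ I.kappa p e := by
  rcases e with a | a
  · exact (h a).2
  · have := (h a).1
    simp only [barTgt, barSrc, kappa, Sum.elim_inr]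
    linarith

end Walks

/-! ### Tensions, tropical vertices and the torus -/

section Tensions

variable {V A ι : Type*} [Fintype V] [DecidableEq V]

theorem tension_mem_cube {I : PESP V A} {π : V → ℝ} {p : A → ℤ} :
    I.tension π p ∈ I.cube ↔ π ∈ I.timetablePolyhedron p := by
  refine forall_congr' fun a => ?_
  rw [tension_apply]
  constructor <;> rintro ⟨h1, h2⟩ <;> constructor <;> linarith

theorem sub_eq_kappa {I : PESP V A} {p : A → ℤ} {π : V → ℝ} {L U : Set A}
    (h : I.tension π p ∈ I.cubeFace L U) {e : A ⊕ A} (he : e ∈ barArcs L U) :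
    π (I.barTgt e) - π (I.barSrc e) = I.kappa p e := by
  rcases e with a | a
  · have := h.2.2 a (inl_mem_barArcs.1 he)
    rw [tension_apply] at this
    simp only [barTgt, barSrc, kappa, Sum.elim_inl]
    linarith
  · have := h.2.1 a (inr_mem_barArcs.1 he)
    rw [tension_apply] at this
    simp only [barTgt, barSrc, kappa, Sum.elim_inr]
    linarith

/-- Equal tensions with different integer offsets force the difference of the timetables to change
by multiples of `T` along each arc, and the graph is connected. -/
theorem toTorus_eq_of_tension_eq {I : PESP V A} {π π' : V → ℝ} {p p' : A → ℤ}
    (h : I.tension π p = I.tension π' p') : I.toTorus π = I.toTorus π' := by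
  refine QuotientAddGroup.eq.2 ?_
  obtain ⟨i⟩ := I.connected.nonempty
  have key : ∀ v, ∃ q : ℤ, -π v + π' v = I.T * q + (-π i + π' i) := by
    intro v
    induction I.reachesAll_univ i v with
    | refl => exact ⟨0, by simp⟩
    | tail _ hbc ih =>
      obtain ⟨e, -, rfl, rfl⟩ := hbc
      obtain ⟨q, hq⟩ := ih
      rcases e with a | a
      all_goals
        have ha := congrFun h a
        rw [tension_apply, tension_apply] at ha
        simp only [barSrc, barTgt, Sum.elim_inl, Sum.elim_inr] at hq ⊢
      · refine ⟨q + p a - p' a, ?_⟩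
        push_cast
        linarith
      · refine ⟨q - p a + p' a, ?_⟩
        push_cast
        linarith
  choose q hq using key
  exact ⟨q, _, hq⟩

omit [Fintype V] [DecidableEq V] in
theorem isTropicallyConvex_timetablePolyhedron (I : PESP V A) (p : A → ℤ) :
    IsTropicallyConvex (I.timetablePolyhedron p) := by
  intro x hx y hy a b e
  obtain ⟨h1, h2⟩ := hx e
  obtain ⟨h3, h4⟩ := hy e
  dsimp only
  constructor
  · rcases min_choice (a + x (I.tgt e)) (b + y (I.tgt e)) with h | h <;> rw [h]
    · linarith [min_le_left (a + x (I.src e)) (b + y (I.src e))]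
    · linarith [min_le_right (a + x (I.src e)) (b + y (I.src e))]
  · rcases min_choice (a + x (I.src e)) (b + y (I.src e)) with h | h <;> rw [h]
    · linarith [min_le_left (a + x (I.tgt e)) (b + y (I.tgt e))]
    · linarith [min_le_right (a + x (I.tgt e)) (b + y (I.tgt e))]

variable [Fintype A] [Fintype ι]

theorem IsIntegralCycleBasis.offsetMap_tension {I : PESP V A} {Γ : Matrix ι A ℤ}
    (hΓ : I.IsIntegralCycleBasis Γ) (π : V → ℝ) {p : A → ℤ} {z : ι → ℤ} (hp : Γ *ᵥ p = z) :
    I.offsetMap Γ (I.tension π p) = fun k => (z k : ℝ) := by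
  rw [offsetMap_eq_iff, tension, Matrix.mulVec_add, Matrix.mulVec_neg,
    hΓ.mulVec_transpose_incidence, neg_zero, zero_add, Matrix.mulVec_smul, ← hp]
  congr 1
  ext k
  simp [Matrix.mulVec, dotProduct]

theorem IsIntegralCycleBasis.exists_eq_tension {I : PESP V A} {Γ : Matrix ι A ℤ}
    (hΓ : I.IsIntegralCycleBasis Γ) {p : A → ℤ} {z : ι → ℤ} (hp : Γ *ᵥ p = z) {x : A → ℝ}
    (hx : I.offsetMap Γ x = fun k => (z k : ℝ)) : ∃ π : V → ℝ, x = I.tension π p := by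
  rw [← hΓ.offsetMap_tension 0 hp] at hx
  obtain ⟨c, hc⟩ := hΓ.offsetMap_eq_offsetMap.1 hx
  refine ⟨-c, funext fun a => ?_⟩
  have := hc a
  rw [tension_apply] at this ⊢
  simp only [Pi.zero_apply, Pi.neg_apply] at this ⊢
  linarith

omit [Fintype A] [Fintype ι] in
/-- A timetable whose tension lies in a face that reaches all vertices from `i` is maximal relative
to its value at `i`. -/
theorem ReachesAll.timetable_sub_le {I : PESP V A} {L U : Set A} {i : V}
    (h : I.ReachesAll (barArcs L U) i) {p : A → ℤ} {π ρ : V → ℝ}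
    (hπ : I.tension π p ∈ I.cubeFace L U) (hρ : ρ ∈ I.timetablePolyhedron p) (v : V) :
    ρ v - ρ i ≤ π v - π i := by
  have := h.potential_le hπ (tension_mem_cube.2 hρ) (c := π - ρ) (fun a => by
    rw [tension_apply, tension_apply]
    simp only [Pi.sub_apply]
    ring) v
  simp only [Pi.sub_apply] at this
  linarith

theorem IsIntegralCycleBasis.isTropicalVertexAt {I : PESP V A}
    (hfree : ∀ a, I.l a < I.u a) {Γ : Matrix ι A ℤ} (hΓ : I.IsIntegralCycleBasis Γ) {i : V}
    {L U : Set A} (h : I.ReachesAll (barArcs L U) i) {p : A → ℤ} {π : V → ℝ}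
    (hπ : I.tension π p ∈ I.cubeFace L U) : I.IsTropicalVertexAt p i π := by
  have hπR := tension_mem_cube.1 hπ.1
  -- The same fibre is used with every vertex `j` as root, which supplies the extremal points that
  -- generate the polytrope.
  have key : ∀ j, ∃ ρ ∈ I.timetablePolyhedron p, ∀ x ∈ I.timetablePolyhedron p, ∀ v,
      x v - x j ≤ ρ v - ρ j := by
    intro j
    obtain ⟨L', U', -, hr, x, hx, hxπ⟩ := hΓ.exists_mem_cubeFace hfree j hπ.1
    rw [hΓ.offsetMap_tension π rfl] at hxπ
    obtain ⟨ρ, rfl⟩ := hΓ.exists_eq_tension rfl hxπ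
    exact ⟨ρ, tension_mem_cube.1 hx.1, fun y hy v => hr.timetable_sub_le hx hy v⟩
  choose ρ hρ hmax using key
  refine ⟨isTropicalVertex_of_forall_le (I.isTropicallyConvex_timetablePolyhedron p) hρ hmax hπR
    fun x hx v => h.timetable_sub_le hπ hx v, fun j => ⟨?_, fun c hc => ?_⟩⟩
  · exact h.isWalk (fun e he => sub_eq_kappa hπ he) j
  · exact IsWalk.sub_le (fun e _ => sub_le_kappa hπR e) hc

/-- Uniqueness holds because competing tensions lie in the same face and the same fibre, hence
coincide, and a tension determines its point of the torus for any choice of `p`. -/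
theorem IsIntegralCycleBasis.exists_torus_point {I : PESP V A}
    (hfree : ∀ a, I.l a < I.u a) {Γ : Matrix ι A ℤ} (hΓ : I.IsIntegralCycleBasis Γ) {i : V}
    {L U : Set A} (h : I.ReachesAll (barArcs L U) i) {z : ι → ℤ}
    (hz : (fun k => (z k : ℝ)) ∈ I.offsetMap Γ '' I.cubeFace L U) :
    ∃ t : I.Torus, I.IsTorusTropicalVertexAt Γ z i t ∧ I.DefinesPoint Γ z L U t := by
  obtain ⟨x, hx, hxz⟩ := hz
  obtain ⟨p, hp⟩ := hΓ.exists_integer_preimage z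
  obtain ⟨π, rfl⟩ := hΓ.exists_eq_tension hp hxz
  have hπR := tension_mem_cube.1 hx.1
  refine ⟨I.toTorus π, ⟨⟨p, hp, π, hπR, rfl⟩, fun p' hp' => ?_⟩, ?_⟩
  · obtain ⟨π', hπ'⟩ := hΓ.exists_eq_tension hp' hxz
    exact ⟨π', hΓ.isTropicalVertexAt hfree h (hπ' ▸ hx), toTorus_eq_of_tension_eq hπ'.symm⟩
  · refine Set.eq_singleton_iff_unique_mem.2 ⟨⟨_, hx, p, π, hp, hπR, rfl, rfl⟩, ?_⟩
    rintro _ ⟨_, hx', p', π', hp', -, rfl, rfl⟩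
    exact toTorus_eq_of_tension_eq (hΓ.eq_of_offsetMap_eq h h hx' hx
      ((hΓ.offsetMap_tension π' hp').trans hxz.symm))

theorem IsIntegralCycleBasis.isShortestPathArborescence {I : PESP V A} {Γ : Matrix ι A ℤ}
    (hΓ : I.IsIntegralCycleBasis Γ) {i : V} {L U : Set A}
    (h : I.IsArborescence (barArcs L U) i) {z : ι → ℤ}
    (hz : (fun k => (z k : ℝ)) ∈ I.offsetMap Γ '' I.cubeFace L U) {p : A → ℤ}
    (hp : Γ *ᵥ p = z) : I.IsShortestPathArborescence (I.kappa p) (barArcs L U) i := by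
  obtain ⟨x, hx, hxz⟩ := hz
  obtain ⟨π, rfl⟩ := hΓ.exists_eq_tension hp hxz
  refine ⟨h, fun v c hc c' hc' => ?_⟩
  rw [hc.eq_sub fun e he => sub_eq_kappa hx he]
  exact hc'.sub_le fun e _ => sub_le_kappa (tension_mem_cube.1 hx.1) e

end Tensions

end PESP

theorem mainTheorem8 {V A ι : Type*} [Fintype V] [DecidableEq V] [Fintype A] [Fintype ι]
    (I : PESP V A) (hfree : ∀ a, I.l a < I.u a)
    (Γ : Matrix ι A ℤ) (hΓ : I.IsIntegralCycleBasis Γ) (i : V) :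
    ∃ 𝒯 : Set (Set (ι → ℝ)),
      𝒯 = I.inducedCells Γ i ∧
      IsFineZonotopalTiling (I.scaledCycleMatrix Γ) (I.offsetZonotope Γ) 𝒯 ∧
      ∀ C ∈ tiles 𝒯, ∃ S L U : Set A,
        I.IsSpanningTreeStructure S L U ∧
        IsFaceOf (I.coneSum i) (I.cubeFace L U) ∧
        C = I.offsetMap Γ '' I.cubeFace L U ∧
        I.IsArborescence (PESP.barArcs L U) i ∧
        ∀ z : ι → ℤ, (fun k => (z k : ℝ)) ∈ C →
          (∀ p : A → ℤ, Γ *ᵥ p = z →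
            I.IsShortestPathArborescence (I.kappa p) (PESP.barArcs L U) i) ∧
          ∃ t : I.Torus, I.IsTorusTropicalVertexAt Γ z i t ∧ I.DefinesPoint Γ z L U t := by
  refine ⟨_, rfl, hΓ.isFineZonotopalTiling_inducedCells hfree i, fun C hC => ?_⟩
  obtain ⟨L, U, hLU, hr, rfl⟩ := PESP.mem_inducedCells_iff.1 hC.prop
  obtain ⟨L', hL, U', hU, harb, htree⟩ := hr.exists_arborescence hLU
  have hr' : I.ReachesAll (PESP.barArcs L' U') i := harb.reachable
  have hLU' := htree.2.1
  -- Fewer fixed coordinates give a larger face, whose image is again a cell by reachability;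
  -- maximality of the tile forces equality.
  have heq : I.offsetMap Γ '' I.cubeFace L U = I.offsetMap Γ '' I.cubeFace L' U' :=
    hC.eq_of_le (PESP.mem_inducedCells_iff.2 ⟨L', U', hLU', hr', rfl⟩)
      (Set.image_mono (I.cubeFace_anti hL hU))
  rw [heq]
  exact ⟨L' ∪ U', L', U', htree, PESP.isFaceOf_coneSum_cubeFace hLU' hr', rfl, harb,
    fun z hz => ⟨fun p hp => hΓ.isShortestPathArborescence harb hz hp,
      hΓ.exists_torus_point hfree hr' hz⟩⟩
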